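/- Let $f_l,f_r:\mathbb R\to\mathbb R$ be smooth and Lipschitz with $f_l(0)=f_r(0)=0$ and $f_l(1)=f_r(1)$, and let $f(x,\omega)=f_l(\omega)$ for $x\le 0$, $f(x,\omega)=f_r(\omega)$ for $x>0$. Let $\lambda>0$ and let $w\in L^1(\mathbb R)\cap BV(\mathbb R)$ with $0\le w\le 1$ a.e. For $\varepsilon>0$ let $J^\varepsilon_\lambda w$ denote the unique weak solution $v\in L^1(\mathbb R)$ of $$v+\lambda\,[f(x,v)-\varepsilon v_x]_x=w ,$$ i.e. $\int_{\mathbb R}\big[\tfrac{v-w}{\lambda}\phi-f(x,v)\phi'-\varepsilon v\phi''\big]dx=0$ for all $\phi\in C^2_c(\mathbb R)$; this solution exists, is unique in $L^1(\mathbb R)$ and has a continuous representative, which is the one used below. Then every sequence $\varepsilon_\nu>0$ with $\varepsilon_\nu\to0$ has a subsequence $\varepsilon_{\nu_j}$ such that $J^{\varepsilon_{\nu_j}}_\lambda w$ converges pointwise on $\mathbb R$ to a function $u$ which is integrable and of bounded total variation and satisfies $$u+\lambda f(x,u)_x=w$$ in the sense of distributions. Furthermore, for every smooth convex $\eta:\mathbb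 R\to\mathbb R$, with $q(x,\omega)=\int_0^\omega \eta'(s)\,\partial_s f(x,s)\,ds$ and $\delta_0$ the unit mass at the origin, $$\lambda\,\delta_0\int_0^{u(0)}\eta''(\omega)\,[f_r(\omega)-f_l(\omega)]\,d\omega+\lambda\, q(x,u)_x+\eta'(u)\,[u-w]\le 0$$ in the sense of distributions. Moreover, if $u$ is discontinuous at $x_o$ and $u^\pm=u(x_o\pm)$, then $$f(x_o-,u^-)=f(x_o+,u^+)=:\bar f,$$ and the following hold: 1. if $u^-<u^+$ and $x_o\ne0$, then $f(x_o,k)\ge\bar f$ for all $k\in[u^-,u^+]$; 2. if $u^->u^+$ and $x_o\ne0$, then $f(x_o,k)\le\bar f$ for all $k\in[u^+,u^-]$; 3. if $u^-<u^+$ and $x_o=0$, then there is $u^*\in[u^-,u^+]$ such that $f_l(k)\ge\bar f$ for all $k\in[u^-,u^*]$ and $f_r(k)\ge\bar f$ for all $k\in[u^*,u^+]$; 4. if $u^->u^+$ and $x_o=0$, then there is $u^*\in[u^+,u^-]$ such that $f_r(k)\le\bar f$ for all $k\in[u^+,u^*]$ and $f_l(k)\le\bar f$ for all $k\in[u^*,u^-]$.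 -/

import Mathlib

open Set Filter Topology MeasureTheory
open scoped ContDiff

noncomputable section

/-- Hypothesis f0 on the flux `f (x, y)`: for each `y` the map `x ↦ f x y` is in `L^∞(ℝ)`; for each
`x` the map `y ↦ f x y` is smooth; `f` is Lipschitz in `y` uniformly in `x`; and `f (·, 0)` is in
`L¹(ℝ)`. -/
structure FluxF0 (f : ℝ → ℝ → ℝ) : Prop where
  memLp_top : ∀ y : ℝ, MemLp (fun x => f x y) ⊤ volume
  smooth : ∀ x : ℝ, ContDiff ℝ ∞ (f x)
  lipschitz : ∃ L : ℝ, 0 ≤ L ∧ ∀ x y₁ y₂ : ℝ, |f x y₁ - f x y₂| ≤ L * |y₁ - y₂|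
  integrable_zero : ∃ L₁ : ℝ, 0 ≤ L₁ ∧ ∫⁻ x, ENNReal.ofReal |f x 0| ≤ ENNReal.ofReal L₁

/-- Hypothesis f1: `f` satisfies f0, equals the smooth function `fl` for `x ≤ 0` and the smooth
function `fr` for `x > 0`, with `fl 0 = fr 0 = 0` and `fl 1 = fr 1`. -/
structure FluxF1 (f : ℝ → ℝ → ℝ) (fl fr : ℝ → ℝ) : Prop where
  f0 : FluxF0 f
  eq_left : ∀ x y : ℝ, x ≤ 0 → f x y = fl y
  eq_right : ∀ x y : ℝ, 0 < x → f x y = fr y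
  smooth_left : ContDiff ℝ ∞ fl
  smooth_right : ContDiff ℝ ∞ fr
  left_zero : fl 0 = 0
  right_zero : fr 0 = 0
  one_eq : fl 1 = fr 1

/-- The domain `D` of integrable functions with values in `[0, 1]` (almost everywhere). -/
def domainD : Set (ℝ → ℝ) :=
  {w | Integrable w volume ∧ ∀ᵐ x ∂(volume : Measure ℝ), 0 ≤ w x ∧ w x ≤ 1}

/-- `w ∈ BV(ℝ)`, for a function considered up to null sets: `w` is integrable and has a
representative of finite total variation. -/
def MemBV (w : ℝ → ℝ) : Prop :=
  Integrable w volume ∧ ∃ v : ℝ → ℝ, v =ᵐ[volume] w ∧ BoundedVariationOn v univ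

/-- Weak solutions `u` of `u + lam * (f (x, u) - ε u_x)_x = w`, tested against `C²_c(ℝ)`. -/
def IsWeakSolution (f : ℝ → ℝ → ℝ) (lam ε : ℝ) (w u : ℝ → ℝ) : Prop :=
  LocallyIntegrable u volume ∧
    ∀ φ : ℝ → ℝ, ContDiff ℝ 2 φ → HasCompactSupport φ →
      ∫ x, ((u x - w x) / lam * φ x - f x (u x) * deriv φ x - ε * u x * iteratedDeriv 2 φ x) = 0

/-- `u` is the continuous representative of a weak solution in `L¹(ℝ)` of the viscous resolvent
equation `u + lam * (f (x, u) - ε u_x)_x = w`. -/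
structure IsViscousResolvent (f : ℝ → ℝ → ℝ) (lam ε : ℝ) (w u : ℝ → ℝ) : Prop where
  continuous : Continuous u
  integrable : Integrable u volume
  weakSolution : IsWeakSolution f lam ε w u

/-- The backward Euler operator `w ↦ J^ε_lam w` of the viscous equation: the continuous
representative of the `L¹` weak solution of the resolvent equation. -/
def viscousResolvent (f : ℝ → ℝ → ℝ) (lam ε : ℝ) (w : ℝ → ℝ) : ℝ → ℝ :=
  Classical.epsilon (fun u : ℝ → ℝ => IsViscousResolvent f lam ε w u)

/-- `u + lam * f (x, u)_x = w` in the sense of distributions on `ℝ`. -/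
def SolvesLimitEquation (f : ℝ → ℝ → ℝ) (lam : ℝ) (w u : ℝ → ℝ) : Prop :=
  ∀ φ : ℝ → ℝ, ContDiff ℝ ∞ φ → HasCompactSupport φ →
    ∫ x, (u x * φ x - lam * f x (u x) * deriv φ x) = ∫ x, w x * φ x

/-- The entropy flux `q (x, y) = ∫₀^y η'(s) ∂_s f(x, s) ds`. -/
def entropyFlux (f : ℝ → ℝ → ℝ) (η : ℝ → ℝ) (x y : ℝ) : ℝ :=
  ∫ s in (0 : ℝ)..y, deriv η s * deriv (f x) s

/-- The inequality
`lam δ₀ ∫₀^{u(0)} η'' (fr - fl) dy + lam q(x, u)_x + η'(u) (u - w) ≤ 0`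
in the sense of distributions, for every smooth convex `η`. -/
def EntropyInequality (f : ℝ → ℝ → ℝ) (fl fr : ℝ → ℝ) (lam : ℝ) (w u : ℝ → ℝ) : Prop :=
  ∀ η : ℝ → ℝ, ContDiff ℝ ∞ η → ConvexOn ℝ univ η →
    ∀ φ : ℝ → ℝ, ContDiff ℝ ∞ φ → HasCompactSupport φ → (∀ x, 0 ≤ φ x) →
      lam * φ 0 * (∫ y in (0 : ℝ)..(u 0), iteratedDeriv 2 η y * (fr y - fl y))
        - lam * (∫ x, entropyFlux f η x (u x) * deriv φ x)
        + ∫ x, deriv η (u x) * (u x - w x) * φ x ≤ 0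

end

/-! The viscous equation is treated as a first order system for the profile `v` and the total flux
`F = f(x, v) - ε v'`: here `F' = (w - v) / λ` and `ε v' = f(x, v) - F`. Both unknowns are absolutely
continuous even though `f` jumps at the origin, so the interface needs no separate transmission
condition. By a du Bois-Reymond argument, integrable weak solutions are exactly the integrable
solutions of this system (`ResolventPair`), up to null sets.

The main estimate is of Kato type (`integral_abs_le_of_isPrimitive`): multiply the equation for a
difference of two solutions by a smoothed sign of the difference. Only the Lipschitz bound on the
flux enters. On the whole line it gives `L¹` contraction, hence uniqueness and, together with
conservation of mass, positivity; applied locally to `1 - v` it gives `v ≤ 1`. Existence for small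
`λ` is a fixed point of a linear solution operator, and a resolvent identity extends it to every
`λ`.

Applied to `v(x + t) - v(x)` on one side of the origin, where the equation is translation invariant,
the same estimate bounds the variation of `v` on each half line by a constant independent of `ε`,
since `F` is `1/λ`-Lipschitz and controls the boundary terms. Helly's theorem then yields a
subsequence converging at every point to some `u` of bounded variation. The fluxes converge to a
Lipschitz function `F₀`, with `F₀ = f(x, u)` almost everywhere, which is the limit equation.

For the jump conditions: if a profile crosses a level `k` upwards in a short interval, then
somewhere in it the total flux is at most the flux of `k` (`exists_flux_le_of_crossing`). Letting
`ε` tend to `0` and then shrinking the interval compares `F₀(x₀)` with the flux of `k`. At the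
origin, `u(0)` decides on which side each level is crossed. For the entropy inequality, test with
`η'(v) φ` and discard the dissipation `ε η''(v) v'² φ`; integrating by parts on each half line
leaves the point mass at the origin. -/

noncomputable section

/-! ### Calculus of absolutely continuous functions and their primitives -/

/-- `G` is a primitive of the function `g`, integrable on bounded intervals. -/
structure IsPrimitive (G g : ℝ → ℝ) : Prop where
  intervalIntegrable : ∀ a b : ℝ, IntervalIntegrable g volume a b
  sub_eq : ∀ x y : ℝ, G y - G x = ∫ t in x..y, g t

theorem MeasureTheory.LocallyIntegrable.intervalIntegrable_real {g : ℝ → ℝ}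
    (hg : LocallyIntegrable g volume) (a b : ℝ) : IntervalIntegrable g volume a b :=
  intervalIntegrable_iff.mpr
    ((hg.integrableOn_isCompact isCompact_uIcc).mono_set uIoc_subset_uIcc)

theorem locallyIntegrable_of_intervalIntegrable {g : ℝ → ℝ}
    (hg : ∀ a b : ℝ, IntervalIntegrable g volume a b) : LocallyIntegrable g volume := by
  rw [locallyIntegrable_iff]
  intro K hK
  obtain ⟨r, hr⟩ := (Metric.isBounded_iff_subset_closedBall 0).1 hK.isBounded
  rw [Real.closedBall_eq_Icc] at hr
  rcases le_or_gt (0 - r) (0 + r) with h | h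
  · have := hg (0 - r) (0 + r)
    rw [intervalIntegrable_iff_integrableOn_Icc_of_le h] at this
    exact this.mono_set hr
  · rw [Icc_eq_empty (not_le.2 h), subset_empty_iff] at hr
    simp [hr]

theorem AbsolutelyContinuousOnInterval.comp_contDiff {G : ℝ → ℝ} {a b : ℝ}
    (hG : AbsolutelyContinuousOnInterval G a b) {S : ℝ → ℝ} (hS : ContDiff ℝ 1 S) :
    AbsolutelyContinuousOnInterval (fun x => S (G x)) a b := by
  obtain ⟨C, hC⟩ := hG.exists_bound
  obtain ⟨K, hK⟩ := (hS.contDiffOn (s := Icc (-C) C)).exists_lipschitzOnWith (by decide)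
    (convex_Icc _ _) isCompact_Icc
  have hmem : ∀ x ∈ uIcc a b, G x ∈ Icc (-C) C := fun x hx => abs_le.1 (hC x hx)
  rw [absolutelyContinuousOnInterval_iff] at hG ⊢
  intro ε hε
  -- Dividing by `K + 1` rather than `K` keeps the tolerance positive when `K = 0`.
  obtain ⟨δ, hδ, h⟩ := hG (ε / (K + 1)) (by positivity)
  refine ⟨δ, hδ, fun E hE hlt => ?_⟩
  have h1 := h E hE hlt
  calc ∑ i ∈ Finset.range E.1, dist (S (G (E.2 i).1)) (S (G (E.2 i).2))
      ≤ ∑ i ∈ Finset.range E.1, K * dist (G (E.2 i).1) (G (E.2 i).2) := by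
        refine Finset.sum_le_sum fun i hi => ?_
        exact hK.dist_le_mul _ (hmem _ (hE.1 i hi).1) _ (hmem _ (hE.1 i hi).2)
    _ = K * ∑ i ∈ Finset.range E.1, dist (G (E.2 i).1) (G (E.2 i).2) := by rw [Finset.mul_sum]
    _ ≤ (K + 1) * ∑ i ∈ Finset.range E.1, dist (G (E.2 i).1) (G (E.2 i).2) := by
        exact mul_le_mul_of_nonneg_right (by linarith) (Finset.sum_nonneg fun _ _ => dist_nonneg)
    _ < ε := by
        rw [lt_div_iff₀ (by positivity)] at h1
        linarith

namespace IsPrimitive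

variable {G g H h : ℝ → ℝ}

theorem locallyIntegrable (hG : IsPrimitive G g) : LocallyIntegrable g volume :=
  locallyIntegrable_of_intervalIntegrable hG.intervalIntegrable

theorem eq_add (hG : IsPrimitive G g) (x y : ℝ) : G y = G x + ∫ t in x..y, g t := by
  have := hG.sub_eq x y
  linarith

theorem absolutelyContinuousOnInterval (hG : IsPrimitive G g) (a b : ℝ) :
    AbsolutelyContinuousOnInterval G a b := by
  have h1 := (hG.intervalIntegrable a b).absolutelyContinuousOnInterval_intervalIntegral
    (c := a) left_mem_uIcc
  have h2 : AbsolutelyContinuousOnInterval (fun _ : ℝ => G a) a b :=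
    (contDiff_const.contDiffOn (n := 1)).absolutelyContinuousOnInterval
  have := h2.add h1
  have he : G = (fun _ : ℝ => G a) + fun x => ∫ t in a..x, g t := by
    ext x
    exact hG.eq_add a x
  rwa [he]

theorem continuous (hG : IsPrimitive G g) : Continuous G := by
  have h0 : G = fun x => G 0 + ∫ t in (0 : ℝ)..x, g t := by
    ext x
    exact hG.eq_add 0 x
  rw [h0]
  exact continuous_const.add (intervalIntegral.continuous_primitive (fun a b =>
    hG.intervalIntegrable a b) 0)

theorem ae_hasDerivAt (hG : IsPrimitive G g) : ∀ᵐ x, HasDerivAt G (g x) x := by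
  filter_upwards [_root_.LocallyIntegrable.ae_hasDerivAt_integral hG.locallyIntegrable] with x hx
  have h0 : G = fun x => G 0 + ∫ t in (0 : ℝ)..x, g t := by
    ext x
    exact hG.eq_add 0 x
  rw [h0]
  exact (hx 0).const_add _

/-- The fundamental theorem of calculus for absolutely continuous functions. It reduces the product
and chain rules below to pointwise differentiation almost everywhere. -/
theorem of_ae_hasDerivAt (hG : ∀ a b, AbsolutelyContinuousOnInterval G a b)
    (hg : ∀ᵐ x, HasDerivAt G (g x) x) : IsPrimitive G g := by
  have hae : deriv G =ᵐ[volume] g := by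
    filter_upwards [hg] with x hx using hx.deriv
  constructor
  · intro a b
    exact (hG a b).intervalIntegrable_deriv.congr_ae (ae_restrict_of_ae hae)
  · intro x y
    rw [← (hG x y).integral_deriv_eq_sub]
    exact intervalIntegral.integral_congr_ae (by filter_upwards [hae] with t ht _ using ht)

theorem congr_ae (hG : IsPrimitive G g) (hgh : g =ᵐ[volume] h) : IsPrimitive G h :=
  ⟨fun a b => (hG.intervalIntegrable a b).congr_ae (ae_restrict_of_ae hgh), fun x y => by
    rw [hG.sub_eq, intervalIntegral.integral_congr_ae]
    filter_upwards [hgh] with t ht _ using ht⟩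

theorem mul (hG : IsPrimitive G g) (hH : IsPrimitive H h) :
    IsPrimitive (fun x => G x * H x) (fun x => g x * H x + G x * h x) := by
  refine of_ae_hasDerivAt (fun a b => (hG.absolutelyContinuousOnInterval a b).mul
    (hH.absolutelyContinuousOnInterval a b)) ?_
  filter_upwards [hG.ae_hasDerivAt, hH.ae_hasDerivAt] with x h1 h2 using h1.mul h2

theorem comp_contDiff (hG : IsPrimitive G g) {S : ℝ → ℝ} (hS : ContDiff ℝ 1 S) :
    IsPrimitive (fun x => S (G x)) (fun x => deriv S (G x) * g x) := by
  refine of_ae_hasDerivAt (fun a b =>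
    (hG.absolutelyContinuousOnInterval a b).comp_contDiff hS) ?_
  filter_upwards [hG.ae_hasDerivAt] with x h1
  exact ((hS.differentiable one_ne_zero _).hasDerivAt).comp x h1

theorem of_contDiff (hG : ContDiff ℝ 1 G) : IsPrimitive G (deriv G) :=
  of_ae_hasDerivAt (fun _ _ => hG.contDiffOn.absolutelyContinuousOnInterval)
    (Eventually.of_forall fun x => (hG.differentiable one_ne_zero x).hasDerivAt)

theorem const (c : ℝ) : IsPrimitive (fun _ => c) (fun _ => 0) :=
  ⟨fun _ _ => intervalIntegrable_const, fun _ _ => by simp⟩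

theorem add (hG : IsPrimitive G g) (hH : IsPrimitive H h) :
    IsPrimitive (fun x => G x + H x) (fun x => g x + h x) :=
  ⟨fun a b => (hG.intervalIntegrable a b).add (hH.intervalIntegrable a b), fun x y => by
    rw [intervalIntegral.integral_add (hG.intervalIntegrable _ _) (hH.intervalIntegrable _ _),
      ← hG.sub_eq, ← hH.sub_eq]
    ring⟩

theorem const_mul (hG : IsPrimitive G g) (c : ℝ) :
    IsPrimitive (fun x => c * G x) (fun x => c * g x) :=
  ⟨fun a b => (hG.intervalIntegrable a b).const_mul c, fun x y => by
    rw [intervalIntegral.integral_const_mul, ← hG.sub_eq]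
    ring⟩

theorem neg (hG : IsPrimitive G g) : IsPrimitive (fun x => -G x) (fun x => -g x) := by
  simpa using hG.const_mul (-1)

theorem sub (hG : IsPrimitive G g) (hH : IsPrimitive H h) :
    IsPrimitive (fun x => G x - H x) (fun x => g x - h x) := by
  simpa [sub_eq_add_neg] using hG.add hH.neg

theorem comp_add_right (hG : IsPrimitive G g) (c : ℝ) :
    IsPrimitive (fun x => G (x + c)) (fun x => g (x + c)) :=
  ⟨fun a b => by simpa using (hG.intervalIntegrable (a + c) (b + c)).comp_add_right c,
    fun x y => by rw [hG.sub_eq, intervalIntegral.integral_comp_add_right]⟩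

theorem comp_neg (hG : IsPrimitive G g) :
    IsPrimitive (fun x => G (-x)) (fun x => -g (-x)) :=
  ⟨fun a b => by
      have := (hG.intervalIntegrable (-a) (-b)).comp_sub_left 0
      simp only [zero_sub, neg_neg] at this
      exact this.neg,
    fun x y => by
      rw [hG.sub_eq, intervalIntegral.integral_neg, intervalIntegral.integral_comp_neg,
        intervalIntegral.integral_symm]⟩

theorem integral (hg : ∀ a b, IntervalIntegrable g volume a b) (c : ℝ) :
    IsPrimitive (fun x => ∫ t in c..x, g t) g :=
  ⟨hg, fun _ _ => intervalIntegral.integral_interval_sub_left (hg _ _) (hg _ _)⟩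

theorem integral_parts (hG : IsPrimitive G g) (hH : IsPrimitive H h) (a b : ℝ) :
    ∫ x in a..b, g x * H x = G b * H b - G a * H a - ∫ x in a..b, G x * h x := by
  rw [(hG.mul hH).sub_eq a b, intervalIntegral.integral_add, add_sub_cancel_right]
  · exact (hG.intervalIntegrable a b).mul_continuousOn hH.continuous.continuousOn
  · exact (hH.intervalIntegrable a b).continuousOn_mul hG.continuous.continuousOn

end IsPrimitive

/-! ### Smoothed sign and the Kato estimate -/

/-- A smooth approximation of the sign function. -/
def smoothSign (δ y : ℝ) : ℝ := y / √(y ^ 2 + δ ^ 2)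

section smoothSign

variable {δ : ℝ}

theorem contDiff_smoothSign (hδ : 0 < δ) : ContDiff ℝ 1 (smoothSign δ) := by
  have hq : ∀ y : ℝ, y ^ 2 + δ ^ 2 ≠ 0 := fun y => by positivity
  have h1 : ContDiff ℝ 1 (fun y : ℝ => √(y ^ 2 + δ ^ 2)) := ContDiff.sqrt (by fun_prop) hq
  exact contDiff_id.div h1 fun y => by positivity

theorem deriv_smoothSign (hδ : 0 < δ) (y : ℝ) :
    deriv (smoothSign δ) y = δ ^ 2 / ((y ^ 2 + δ ^ 2) * √(y ^ 2 + δ ^ 2)) := by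
  have hq : 0 < y ^ 2 + δ ^ 2 := by positivity
  have h0 : HasDerivAt (fun y : ℝ => y ^ 2 + δ ^ 2) (2 * y) y := by
    simpa using ((hasDerivAt_id y).pow 2).add_const (δ ^ 2)
  have h1 := (hasDerivAt_id y).div (h0.sqrt hq.ne') (by positivity)
  have hs : √(y ^ 2 + δ ^ 2) ^ 2 = y ^ 2 + δ ^ 2 := Real.sq_sqrt hq.le
  have hs0 : 0 < √(y ^ 2 + δ ^ 2) := Real.sqrt_pos.2 hq
  refine h1.deriv.trans ?_
  simp only [id]
  rw [hs]
  generalize √(y ^ 2 + δ ^ 2) = s at *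
  field_simp
  rw [hs]
  ring

theorem deriv_smoothSign_nonneg (hδ : 0 < δ) (y : ℝ) : 0 ≤ deriv (smoothSign δ) y := by
  rw [deriv_smoothSign hδ]
  positivity

/-- The derivative concentrates at the origin like a point mass, and the factor `y ^ 2` kills it.
This is what makes the flux term in the Kato estimate disappear as `δ → 0`. -/
theorem deriv_smoothSign_mul_sq_le (hδ : 0 < δ) (y : ℝ) :
    deriv (smoothSign δ) y * y ^ 2 ≤ δ := by
  rw [deriv_smoothSign hδ, div_mul_eq_mul_div, div_le_iff₀ (by positivity)]
  have h1 : δ ≤ √(y ^ 2 + δ ^ 2) := Real.le_sqrt_of_sq_le (by nlinarith [sq_nonneg y])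
  calc δ ^ 2 * y ^ 2 ≤ δ ^ 2 * (y ^ 2 + δ ^ 2) := by gcongr; nlinarith [sq_nonneg δ]
    _ = δ * ((y ^ 2 + δ ^ 2) * δ) := by ring
    _ ≤ δ * ((y ^ 2 + δ ^ 2) * √(y ^ 2 + δ ^ 2)) := by gcongr

theorem abs_smoothSign_le (hδ : 0 < δ) (y : ℝ) : |smoothSign δ y| ≤ 1 := by
  rw [smoothSign, abs_div, abs_of_pos (a := √(y ^ 2 + δ ^ 2)) (by positivity),
    div_le_one (by positivity)]
  exact Real.abs_le_sqrt (by nlinarith [sq_nonneg δ])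

theorem sub_le_mul_smoothSign (hδ : 0 < δ) (y : ℝ) : |y| - δ ≤ y * smoothSign δ y := by
  have hs0 : 0 < √(y ^ 2 + δ ^ 2) := by positivity
  have hs : √(y ^ 2 + δ ^ 2) ^ 2 = y ^ 2 + δ ^ 2 := Real.sq_sqrt (by positivity)
  have h1 : √(y ^ 2 + δ ^ 2) ≤ |y| + δ := by
    rw [← sq_abs y]
    exact Real.sqrt_le_iff.2 ⟨by positivity, by nlinarith [abs_nonneg y]⟩
  rw [smoothSign, ← mul_div_assoc, le_div_iff₀ hs0]
  rcases le_or_gt (|y|) δ with h | h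
  · nlinarith [mul_nonneg (sub_nonneg.2 h) hs0.le, mul_self_nonneg y]
  · calc (|y| - δ) * √(y ^ 2 + δ ^ 2) ≤ (|y| - δ) * (|y| + δ) := by gcongr
      _ ≤ y * y := by nlinarith [abs_mul_abs_self y, sq_nonneg δ]

/-- The limit is the sign of `y`; at `y = 0` division by zero gives the value `0`, as needed. -/
theorem tendsto_smoothSign (y : ℝ) :
    Tendsto (fun δ => smoothSign δ y) (𝓝[>] 0) (𝓝 (y / |y|)) := by
  rcases eq_or_ne y 0 with rfl | hy
  · simp [smoothSign]
  · have h1 : ContinuousAt (fun δ => smoothSign δ y) 0 := by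
      unfold smoothSign
      refine continuousAt_const.div (by fun_prop) ?_
      simp only [ne_eq, OfNat.ofNat_ne_zero, not_false_eq_true, zero_pow, add_zero]
      rw [Real.sqrt_sq_eq_abs]
      simpa using hy
    have h2 := h1.tendsto
    simp only [smoothSign, ne_eq, OfNat.ofNat_ne_zero, not_false_eq_true, zero_pow, add_zero,
      Real.sqrt_sq_eq_abs] at h2
    exact h2.mono_left nhdsWithin_le_nhds

end smoothSign

theorem abs_div_abs_self_le (y : ℝ) : |(y / |y|)| ≤ 1 := by
  rw [abs_div, abs_abs]
  exact div_self_le_one _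

/-- Kato-type estimate behind the `L¹` contraction property of the viscous resolvent. -/
theorem integral_abs_le_of_isPrimitive {d D g om : ℝ → ℝ} {lam ε L a b : ℝ}
    (hlam : 0 < lam) (hε : 0 < ε) (hab : a ≤ b)
    (hd : IsPrimitive d fun x => (g x - D x) / ε)
    (hD : IsPrimitive D fun x => (om x - d x) / lam)
    (hom : IntervalIntegrable om volume a b)
    (hg : ∀ x ∈ Icc a b, |g x| ≤ L * |d x|) :
    ∫ x in a..b, |d x| ≤
      (∫ x in a..b, |om x|) + lam * (D a * (d a / |d a|) - D b * (d b / |d b|)) := by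
  have hdc := hd.continuous
  have key : ∀ δ : ℝ, 0 < δ → ∫ x in a..b, |d x| ≤
      (∫ x in a..b, |om x|) + lam * (D a * smoothSign δ (d a) - D b * smoothSign δ (d b))
        + (1 + lam * L ^ 2 / (4 * ε)) * (b - a) * δ := by
    intro δ hδ
    have hS := contDiff_smoothSign hδ
    have hSd := hd.comp_contDiff hS
    have hSc := hSd.continuous
    -- The equation for `D` is tested against the smoothed sign of `d`; integration by parts moves
    -- the derivative onto the sign and produces `D S'(d) d'`.
    have hparts := hD.integral_parts hSd a b
    -- Completing the square gives `D (g - D) ≤ g² / 4`, then `g² ≤ L² d²` and `S'(d) d² ≤ δ` make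
    -- the term of order `δ`. No monotonicity or regularity of the flux in `x` is used.
    have h1 : ∫ x in a..b, D x * (deriv (smoothSign δ) (d x) * ((g x - D x) / ε)) ≤
        ∫ x in a..b, L ^ 2 / (4 * ε) * δ := by
      refine intervalIntegral.integral_mono_on hab
        ((hSd.intervalIntegrable a b).continuousOn_mul hD.continuous.continuousOn)
        intervalIntegrable_const fun x hx => ?_
      have hS0 := deriv_smoothSign_nonneg hδ (d x)
      have hS1 := deriv_smoothSign_mul_sq_le hδ (d x)
      set s := deriv (smoothSign δ) (d x)
      have hg2 : g x ^ 2 ≤ L ^ 2 * d x ^ 2 := by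
        rw [← sq_abs (g x), ← sq_abs (d x), ← mul_pow]
        exact pow_le_pow_left₀ (abs_nonneg _) (hg x hx) 2
      calc D x * (s * ((g x - D x) / ε)) = s * (D x * (g x - D x)) / ε := by ring
        _ ≤ s * (g x ^ 2 / 4) / ε := by
            gcongr
            nlinarith [sq_nonneg (g x - 2 * D x)]
        _ ≤ s * (L ^ 2 * d x ^ 2 / 4) / ε := by gcongr
        _ = (s * d x ^ 2) * (L ^ 2 / (4 * ε)) := by field_simp
        _ ≤ δ * (L ^ 2 / (4 * ε)) := by gcongr
        _ = L ^ 2 / (4 * ε) * δ := by ring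
    rw [intervalIntegral.integral_const, smul_eq_mul] at h1
    have hi1 : IntervalIntegrable (fun x => om x * smoothSign δ (d x)) volume a b :=
      hom.mul_continuousOn hSc.continuousOn
    have hi2 : IntervalIntegrable (fun x => d x * smoothSign δ (d x)) volume a b :=
      (hdc.mul hSc).intervalIntegrable a b
    have h2 : ∫ x in a..b, (om x - d x) / lam * smoothSign δ (d x) =
        ((∫ x in a..b, om x * smoothSign δ (d x)) - ∫ x in a..b, d x * smoothSign δ (d x))
          / lam := by
      rw [← intervalIntegral.integral_sub hi1 hi2, ← intervalIntegral.integral_div]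
      congr 1
      ext x
      ring
    have h3 : ∫ x in a..b, om x * smoothSign δ (d x) ≤ ∫ x in a..b, |om x| := by
      refine intervalIntegral.integral_mono_on hab hi1 hom.abs fun x _ => ?_
      refine (le_abs_self _).trans ?_
      rw [abs_mul]
      exact mul_le_of_le_one_right (abs_nonneg _) (abs_smoothSign_le hδ _)
    have h4 : (∫ x in a..b, |d x|) - (b - a) * δ ≤ ∫ x in a..b, d x * smoothSign δ (d x) := by
      have : (∫ x in a..b, |d x|) - (b - a) * δ = ∫ x in a..b, (|d x| - δ) := by
        rw [intervalIntegral.integral_sub (hdc.abs.intervalIntegrable a b)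
          intervalIntegrable_const, intervalIntegral.integral_const, smul_eq_mul]
      rw [this]
      exact intervalIntegral.integral_mono_on hab
        ((hdc.abs.sub continuous_const).intervalIntegrable a b) hi2
        fun x _ => sub_le_mul_smoothSign hδ _
    rw [h2, div_eq_iff hlam.ne'] at hparts
    have h5 := mul_le_mul_of_nonneg_right h1 hlam.le
    have h6 : (b - a) * (L ^ 2 / (4 * ε) * δ) * lam = lam * L ^ 2 / (4 * ε) * (b - a) * δ := by
      ring
    nlinarith
  have hlim : Tendsto (fun δ : ℝ => (∫ x in a..b, |om x|)
      + lam * (D a * smoothSign δ (d a) - D b * smoothSign δ (d b))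
        + (1 + lam * L ^ 2 / (4 * ε)) * (b - a) * δ) (𝓝[>] 0)
      (𝓝 ((∫ x in a..b, |om x|) + lam * (D a * (d a / |d a|) - D b * (d b / |d b|))
        + (1 + lam * L ^ 2 / (4 * ε)) * (b - a) * 0)) :=
    ((((tendsto_smoothSign _).const_mul _).sub ((tendsto_smoothSign _).const_mul _)).const_mul
      _ |>.const_add _).add ((tendsto_id.mono_left nhdsWithin_le_nhds).const_mul _)
  have := ge_of_tendsto hlim (by filter_upwards [self_mem_nhdsWithin] with δ hδ using key δ hδ)
  linarith

theorem not_integrable_of_one_le_abs {d : ℝ → ℝ} {Y : ℝ} (h : ∀ x, Y ≤ x → 1 ≤ |d x|) :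
    ¬ Integrable d volume := by
  intro hd
  have h1 := hd.measure_norm_ge_lt_top one_pos
  have h2 : volume (Ici Y) ≤ volume {x | 1 ≤ ‖d x‖} := measure_mono fun x hx => h x hx
  rw [Real.volume_Ici] at h2
  exact absurd h1 (not_lt.2 h2)

/-- If `d` is integrable and `ε d' = g - D` with `g` integrable, then `D` can only tend to `0`. -/
theorem eq_zero_of_tendsto_atTop {d D g : ℝ → ℝ} {ε c : ℝ} (hε : 0 < ε)
    (hd : IsPrimitive d fun x => (g x - D x) / ε) (hdi : Integrable d volume)
    (hgi : Integrable g volume) (hDc : Continuous D) (hD : Tendsto D atTop (𝓝 c)) : c = 0 := by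
  by_contra hc
  have hc2 : 0 < c ^ 2 / 2 := by positivity
  have hev : ∀ᶠ x in atTop, c ^ 2 / 2 < c * D x := by
    have : Tendsto (fun x => c * D x) atTop (𝓝 (c * c)) := hD.const_mul c
    exact this.eventually (lt_mem_nhds (by nlinarith))
  obtain ⟨X, hX⟩ := eventually_atTop.1 hev
  set M := ∫ x, |g x| with hM
  -- Once `c D > c² / 2`, the equation forces `c d` to decrease at least linearly, up to the bounded
  -- contribution of `g`; so `|d| ≥ 1` far out, against integrability.
  have hbound : ∀ x, X ≤ x → ε * (c * d x) ≤ ε * (c * d X) + |c| * M - c ^ 2 / 2 * (x - X) := by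
    intro x hx
    have h1 := hd.eq_add X x
    have h2 : ∫ t in X..x, (g t - D t) / ε = ((∫ t in X..x, g t) - ∫ t in X..x, D t) / ε := by
      rw [intervalIntegral.integral_div, intervalIntegral.integral_sub hgi.intervalIntegrable
        (hDc.intervalIntegrable _ _)]
    have h3 : |∫ t in X..x, g t| ≤ M :=
      (intervalIntegral.norm_integral_le_integral_norm_uIoc).trans
        (setIntegral_le_integral hgi.norm (Eventually.of_forall fun _ => norm_nonneg _))
    have h4 : c ^ 2 / 2 * (x - X) ≤ c * ∫ t in X..x, D t := by
      rw [← intervalIntegral.integral_const_mul, mul_comm, ← smul_eq_mul,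
        ← intervalIntegral.integral_const]
      exact intervalIntegral.integral_mono_on hx intervalIntegrable_const
        ((continuous_const.mul hDc).intervalIntegrable _ _) fun t ht => (hX t ht.1).le
    have h5 : c * (∫ t in X..x, g t) ≤ |c| * M := by
      refine (le_abs_self _).trans ?_
      rw [abs_mul]
      gcongr
    rw [h2] at h1
    have h6 : ε * d x = ε * d X + ((∫ t in X..x, g t) - ∫ t in X..x, D t) := by
      rw [h1]
      field_simp
    have h7 : ε * (c * d x) = c * (ε * d x) := by ring
    rw [h7, h6]
    linarith
  have hlim : Tendsto (fun x => ε * (c * d X) + |c| * M - c ^ 2 / 2 * (x - X)) atTop atBot := by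
    have h1 : Tendsto (fun x => c ^ 2 / 2 * (x - X)) atTop atTop :=
      (tendsto_atTop_add_const_right atTop (-X) tendsto_id).const_mul_atTop hc2
    simpa [sub_eq_add_neg] using tendsto_atBot_add_const_left atTop
      (ε * (c * d X) + |c| * M) (tendsto_neg_atTop_atBot.comp h1)
  obtain ⟨Y, hY⟩ := eventually_atTop.1 (hlim.eventually (eventually_le_atBot (-(ε * |c|))))
  refine not_integrable_of_one_le_abs (Y := max X Y) (fun x hx => ?_) hdi
  have h1 := (hbound x ((le_max_left _ _).trans hx)).trans (hY x ((le_max_right _ _).trans hx))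
  have h2 : |c| * 1 ≤ |c| * |d x| := by
    rw [← abs_mul, mul_one]
    have : c * d x ≤ -|c| := by
      by_contra hcon
      have := mul_lt_mul_of_pos_left (not_le.1 hcon) hε
      linarith
    exact (by linarith : |c| ≤ -(c * d x)).trans (neg_le_abs _)
  exact le_of_mul_le_mul_left h2 (abs_pos.2 hc)

theorem tendsto_atTop_of_isPrimitive {d D g om : ℝ → ℝ} {ε : ℝ} (hε : 0 < ε)
    (hd : IsPrimitive d fun x => (g x - D x) / ε) (hdi : Integrable d volume)
    (hgi : Integrable g volume) (hD : IsPrimitive D om) (hom : Integrable om volume) :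
    Tendsto D atTop (𝓝 0) := by
  have h1 : Tendsto D atTop (𝓝 (D 0 + ∫ x in Ioi 0, om x)) := by
    have := (intervalIntegral_tendsto_integral_Ioi 0 hom.integrableOn tendsto_id).const_add (D 0)
    refine this.congr fun x => (hD.eq_add 0 x).symm
  rwa [eq_zero_of_tendsto_atTop hε hd hdi hgi hD.continuous h1] at h1

theorem tendsto_atBot_of_isPrimitive {d D g om : ℝ → ℝ} {ε : ℝ} (hε : 0 < ε)
    (hd : IsPrimitive d fun x => (g x - D x) / ε) (hdi : Integrable d volume)
    (hgi : Integrable g volume) (hD : IsPrimitive D om) (hom : Integrable om volume) :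
    Tendsto D atBot (𝓝 0) := by
  have h1 : Tendsto (fun x => -D (-x)) atTop (𝓝 0) := by
    -- Reflection preserves the form of the system once `g` and `D` change sign.
    refine tendsto_atTop_of_isPrimitive (d := fun x => d (-x)) (g := fun x => -g (-x)) hε ?_
      hdi.comp_neg hgi.comp_neg.neg hD.comp_neg.neg (om := fun x => - -om (-x)) ?_
    · convert hd.comp_neg using 2
      ring
    · simpa using hom.comp_neg
  have h2 := (h1.comp tendsto_neg_atBot_atTop).neg
  simpa [Function.comp_def] using h2

/-- The `L¹` contraction estimate on the whole line. -/
theorem integral_abs_le_integral_abs {d D g om : ℝ → ℝ} {lam ε L : ℝ}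
    (hlam : 0 < lam) (hε : 0 < ε)
    (hd : IsPrimitive d fun x => (g x - D x) / ε)
    (hD : IsPrimitive D fun x => (om x - d x) / lam)
    (hdi : Integrable d volume) (hom : Integrable om volume) (hgi : Integrable g volume)
    (hg : ∀ x, |g x| ≤ L * |d x|) :
    ∫ x, |d x| ≤ ∫ x, |om x| := by
  have hDi : Integrable (fun x => (om x - d x) / lam) volume := (hom.sub hdi).div_const _
  have hT := tendsto_atTop_of_isPrimitive hε hd hdi hgi hD hDi
  have hB := tendsto_atBot_of_isPrimitive hε hd hdi hgi hD hDi
  have h1 : Tendsto (fun n : ℝ => ∫ x in (-n)..n, |d x|) atTop (𝓝 (∫ x, |d x|)) :=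
    intervalIntegral_tendsto_integral hdi.abs tendsto_neg_atTop_atBot tendsto_id
  have h2 : Tendsto (fun n : ℝ => (∫ x, |om x|) + lam * (|D (-n)| + |D n|)) atTop
      (𝓝 ((∫ x, |om x|) + lam * (|(0 : ℝ)| + |(0 : ℝ)|))) :=
    (((hB.comp tendsto_neg_atTop_atBot).abs.add hT.abs).const_mul _).const_add _
  simp only [abs_zero, add_zero, mul_zero] at h2
  refine le_of_tendsto_of_tendsto h1 h2 ?_
  filter_upwards [eventually_ge_atTop 0] with n hn
  have h3 := integral_abs_le_of_isPrimitive hlam hε (by linarith : -n ≤ n) hd hD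
    hom.intervalIntegrable fun x _ => hg x
  have h4 : ∫ x in (-n)..n, |om x| ≤ ∫ x, |om x| := by
    rw [intervalIntegral.integral_of_le (by linarith)]
    exact setIntegral_le_integral hom.abs (Eventually.of_forall fun _ => abs_nonneg _)
  have h5 : ∀ x, |D x * (d x / |d x|)| ≤ |D x| := fun x => by
    rw [abs_mul]
    exact mul_le_of_le_one_right (abs_nonneg _) (abs_div_abs_self_le _)
  have h6 : D (-n) * (d (-n) / |d (-n)|) - D n * (d n / |d n|) ≤ |D (-n)| + |D n| := by
    linarith [(abs_le.1 (h5 (-n))).2, (abs_le.1 (h5 n)).1]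
  have h7 := mul_le_mul_of_nonneg_left h6 hlam.le
  linarith

/-! ### The first order system: contraction, uniqueness and bounds -/

namespace FluxF1

variable {f : ℝ → ℝ → ℝ} {fl fr : ℝ → ℝ}

/-- Since the two fluxes agree at the states `0` and `1`, both constants solve the system across the
interface, with constant total flux. They are the barriers for the bounds on `v`. -/
theorem apply_zero (hf : FluxF1 f fl fr) (x : ℝ) : f x 0 = 0 := by
  rcases le_or_gt x 0 with h | h
  · rw [hf.eq_left x 0 h, hf.left_zero]
  · rw [hf.eq_right x 0 h, hf.right_zero]

theorem apply_one (hf : FluxF1 f fl fr) (x : ℝ) : f x 1 = fl 1 := by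
  rcases le_or_gt x 0 with h | h
  · rw [hf.eq_left x 1 h]
  · rw [hf.eq_right x 1 h, hf.one_eq]

theorem abs_le_mul (hf : FluxF1 f fl fr) {L : ℝ}
    (hL : ∀ x y₁ y₂ : ℝ, |f x y₁ - f x y₂| ≤ L * |y₁ - y₂|) (x y : ℝ) : |f x y| ≤ L * |y| := by
  simpa [hf.apply_zero] using hL x y 0

theorem comp_eq_indicator (hf : FluxF1 f fl fr) (v : ℝ → ℝ) :
    (fun x => f x (v x)) =
      fun x => (Iic 0).indicator (fun x => fl (v x)) x + (Ioi 0).indicator (fun x => fr (v x)) x := by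
  ext x
  rcases le_or_gt x 0 with h | h
  · simp [h, hf.eq_left x _ h]
  · simp [h, hf.eq_right x _ h]

theorem aestronglyMeasurable_comp (hf : FluxF1 f fl fr) {v : ℝ → ℝ}
    (hv : AEStronglyMeasurable v volume) :
    AEStronglyMeasurable (fun x => f x (v x)) volume := by
  rw [hf.comp_eq_indicator]
  exact ((hf.smooth_left.continuous.comp_aestronglyMeasurable hv).indicator measurableSet_Iic).add
    ((hf.smooth_right.continuous.comp_aestronglyMeasurable hv).indicator measurableSet_Ioi)

theorem integrable_comp (hf : FluxF1 f fl fr) {v : ℝ → ℝ} (hv : Integrable v volume) :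
    Integrable (fun x => f x (v x)) volume := by
  obtain ⟨L, -, hL⟩ := hf.f0.lipschitz
  refine (hv.norm.const_mul L).mono' (hf.aestronglyMeasurable_comp hv.1)
    (Eventually.of_forall fun x => hf.abs_le_mul hL _ _)

end FluxF1

/-- The viscous resolvent equation as a first order system for the profile `v` and the total flux
`F = f (x, v) - ε v'`. -/
structure ResolventPair (f : ℝ → ℝ → ℝ) (lam ε : ℝ) (w v F : ℝ → ℝ) : Prop where
  integrable : Integrable v volume
  flux : IsPrimitive F fun x => (w x - v x) / lam
  profile : IsPrimitive v fun x => (f x (v x) - F x) / ε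

namespace ResolventPair

variable {f : ℝ → ℝ → ℝ} {fl fr : ℝ → ℝ} {lam ε : ℝ} {w v F w₁ v₁ F₁ w₂ v₂ F₂ : ℝ → ℝ}

theorem integral_abs_sub_le (hf : FluxF1 f fl fr) (hlam : 0 < lam) (hε : 0 < ε)
    (hw₁ : Integrable w₁ volume) (hw₂ : Integrable w₂ volume)
    (h₁ : ResolventPair f lam ε w₁ v₁ F₁) (h₂ : ResolventPair f lam ε w₂ v₂ F₂) :
    ∫ x, |v₁ x - v₂ x| ≤ ∫ x, |w₁ x - w₂ x| := by
  obtain ⟨L, -, hL⟩ := hf.f0.lipschitz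
  refine integral_abs_le_integral_abs (D := fun x => F₁ x - F₂ x)
    (g := fun x => f x (v₁ x) - f x (v₂ x)) (L := L) hlam hε ?_ ?_
    (h₁.integrable.sub h₂.integrable) (hw₁.sub hw₂)
    ((hf.integrable_comp h₁.integrable).sub (hf.integrable_comp h₂.integrable))
    fun x => hL _ _ _
  · convert h₁.profile.sub h₂.profile using 2
    ring
  · convert h₁.flux.sub h₂.flux using 2
    ring

theorem eq_of_eq (hf : FluxF1 f fl fr) (hlam : 0 < lam) (hε : 0 < ε)
    (hw : Integrable w volume)
    (h₁ : ResolventPair f lam ε w v₁ F₁) (h₂ : ResolventPair f lam ε w v₂ F₂) : v₁ = v₂ := by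
  have h := integral_abs_sub_le hf hlam hε hw hw h₁ h₂
  simp only [sub_self, abs_zero, integral_zero] at h
  have h0 : ∫ x, |v₁ x - v₂ x| = 0 := le_antisymm h (integral_nonneg fun _ => abs_nonneg _)
  replace h0 := (integral_eq_zero_iff_of_nonneg (f := fun x => |v₁ x - v₂ x|)
    (fun _ => abs_nonneg _) (h₁.integrable.sub h₂.integrable).abs).1 h0
  refine Continuous.ae_eq_iff_eq volume h₁.profile.continuous h₂.profile.continuous |>.1 ?_
  filter_upwards [h0] with x hx
  simpa [sub_eq_zero] using hx

theorem tendsto_flux_atTop (hf : FluxF1 f fl fr) (hε : 0 < ε) (hw : Integrable w volume)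
    (h : ResolventPair f lam ε w v F) : Tendsto F atTop (𝓝 0) :=
  tendsto_atTop_of_isPrimitive hε h.profile h.integrable (hf.integrable_comp h.integrable)
    h.flux ((hw.sub h.integrable).div_const _)

theorem tendsto_flux_atBot (hf : FluxF1 f fl fr) (hε : 0 < ε) (hw : Integrable w volume)
    (h : ResolventPair f lam ε w v F) : Tendsto F atBot (𝓝 0) :=
  tendsto_atBot_of_isPrimitive hε h.profile h.integrable (hf.integrable_comp h.integrable)
    h.flux ((hw.sub h.integrable).div_const _)

/-- The total flux vanishes at both ends, so mass is conserved. -/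
theorem integral_eq (hf : FluxF1 f fl fr) (hlam : 0 < lam) (hε : 0 < ε) (hw : Integrable w volume)
    (h : ResolventPair f lam ε w v F) : ∫ x, v x = ∫ x, w x := by
  have hi : Integrable (fun x => (w x - v x) / lam) volume := (hw.sub h.integrable).div_const _
  have h1 : Tendsto (fun n : ℝ => ∫ x in (-n)..n, (w x - v x) / lam) atTop
      (𝓝 (∫ x, (w x - v x) / lam)) :=
    intervalIntegral_tendsto_integral hi tendsto_neg_atTop_atBot tendsto_id
  have h2 : Tendsto (fun n : ℝ => F n - F (-n)) atTop (𝓝 (0 - 0)) :=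
    (h.tendsto_flux_atTop hf hε hw).sub
      ((h.tendsto_flux_atBot hf hε hw).comp tendsto_neg_atTop_atBot)
  simp only [h.flux.sub_eq] at h2
  have h3 := tendsto_nhds_unique h1 h2
  rw [integral_div, integral_sub hw h.integrable, sub_zero, div_eq_zero_iff] at h3
  rcases h3 with h3 | h3
  · linarith
  · exact absurd h3 hlam.ne'

theorem zero (hf : FluxF1 f fl fr) : ResolventPair f lam ε (fun _ => 0) (fun _ => 0) fun _ => 0 :=
  ⟨integrable_zero _ _ _, by simpa using IsPrimitive.const 0,
    by simpa [hf.apply_zero] using IsPrimitive.const 0⟩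

/-- Contraction towards the zero solution gives `∫ |v| ≤ ∫ w`, and `∫ w = ∫ v` by conservation of
mass; hence `|v| = v`. -/
theorem nonneg (hf : FluxF1 f fl fr) (hlam : 0 < lam) (hε : 0 < ε)
    (hw : Integrable w volume) (hw0 : ∀ᵐ x, 0 ≤ w x)
    (h : ResolventPair f lam ε w v F) (x : ℝ) : 0 ≤ v x := by
  have h1 := integral_abs_sub_le hf hlam hε hw (integrable_zero _ _ _) h (zero hf)
  simp only [sub_zero, Pi.zero_apply] at h1
  have h2 : ∫ x, |w x| = ∫ x, w x :=
    integral_congr_ae (by filter_upwards [hw0] with x hx using abs_of_nonneg hx)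
  rw [h2, ← h.integral_eq hf hlam hε hw] at h1
  have h3 : ∫ x, (|v x| - v x) = 0 := by
    refine le_antisymm ?_ (integral_nonneg fun x => sub_nonneg.2 (le_abs_self _))
    rw [integral_sub h.integrable.abs h.integrable]
    linarith
  rw [integral_eq_zero_iff_of_nonneg (fun x => sub_nonneg.2 (le_abs_self _))
    (h.integrable.abs.sub h.integrable)] at h3
  have h4 := Continuous.ae_eq_iff_eq volume (h.profile.continuous.abs.sub h.profile.continuous)
    continuous_zero |>.1 h3
  have h5 := congrFun h4 x
  simp only [Pi.sub_apply, Pi.zero_apply, sub_eq_zero] at h5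
  rw [← h5]
  exact abs_nonneg _

theorem exists_lt_one (h : Integrable v volume) (X : ℝ) : ∃ b, X ≤ b ∧ v b < 1 := by
  by_contra! hcon
  exact not_integrable_of_one_le_abs (fun x hx => (hcon x hx).trans (le_abs_self _)) h

/-- The constant `1` is not integrable, so the global contraction does not apply. The local estimate
is used for `1 - v` on an interval around `x` with `v < 1` at both ends: there the signs in the
boundary terms equal `1`, and these terms combine with the flux balance to give `∫ |1 - v| ≤ ∫ (1 -
v)`. -/
theorem le_one (hf : FluxF1 f fl fr) (hlam : 0 < lam) (hε : 0 < ε)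
    (hw : Integrable w volume) (hw1 : ∀ᵐ x, w x ≤ 1)
    (h : ResolventPair f lam ε w v F) (x : ℝ) : v x ≤ 1 := by
  obtain ⟨L, -, hL⟩ := hf.f0.lipschitz
  obtain ⟨b, hb, hvb⟩ := exists_lt_one h.integrable (x + 1)
  obtain ⟨a', ha', hva⟩ := exists_lt_one h.integrable.comp_neg (-x + 1)
  obtain ⟨a, rfl⟩ : ∃ a, a' = -a := ⟨-a', by ring⟩
  rw [neg_neg] at hva
  have hax : a < x := by linarith
  have hxb : x < b := by linarith
  have hab : a ≤ b := by linarith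
  have hd : IsPrimitive (fun x => 1 - v x) fun x => ((fl 1 - f x (v x)) - (fl 1 - F x)) / ε := by
    convert (IsPrimitive.const 1).sub h.profile using 2
    ring
  have hD : IsPrimitive (fun x => fl 1 - F x) fun x => ((1 - w x) - (1 - v x)) / lam := by
    convert (IsPrimitive.const (fl 1)).sub h.flux using 2
    ring
  have hwi : IntervalIntegrable (fun x => 1 - w x) volume a b :=
    intervalIntegrable_const.sub hw.intervalIntegrable
  have key := integral_abs_le_of_isPrimitive (L := L) hlam hε hab hd hD hwi fun x _ => by
    rw [← hf.apply_one x]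
    exact hL _ _ _
  have hda : (1 - v a) / |1 - v a| = 1 := by
    rw [abs_of_pos (by linarith), div_self (by linarith)]
  have hdb : (1 - v b) / |1 - v b| = 1 := by
    rw [abs_of_pos (by linarith), div_self (by linarith)]
  rw [hda, hdb, mul_one, mul_one] at key
  have h1 := hD.sub_eq a b
  have hvi : IntervalIntegrable (fun x => 1 - v x) volume a b :=
    (continuous_const.sub h.profile.continuous).intervalIntegrable a b
  rw [intervalIntegral.integral_div, intervalIntegral.integral_sub hwi hvi,
    eq_div_iff hlam.ne'] at h1
  have h2 : ∫ x in a..b, |1 - w x| = ∫ x in a..b, (1 - w x) :=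
    intervalIntegral.integral_congr_ae (by
      filter_upwards [hw1] with x hx _ using abs_of_nonneg (sub_nonneg.2 hx))
  rw [h2] at key
  have hc : Continuous fun x => |1 - v x| - (1 - v x) :=
    (continuous_const.sub h.profile.continuous).abs.sub
      (continuous_const.sub h.profile.continuous)
  have h3 : ∫ x in a..b, (|1 - v x| - (1 - v x)) ≤ 0 := by
    rw [intervalIntegral.integral_sub hvi.abs hvi]
    nlinarith
  by_contra hcon
  have h4 : 0 < ∫ x in a..b, (|1 - v x| - (1 - v x)) := by
    refine intervalIntegral.integral_pos (by linarith) hc.continuousOn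
      (fun x _ => sub_nonneg.2 (le_abs_self _)) ⟨x, ⟨hax.le, hxb.le⟩, ?_⟩
    rw [abs_of_neg (by linarith)]
    linarith
  linarith

end ResolventPair

/-! ### Existence for the first order system -/

/-- The solution `p` of `p' = r - p / μ` that is integrable on `ℝ`. -/
def expAverage (μ : ℝ) (r : ℝ → ℝ) (x : ℝ) : ℝ :=
  Real.exp (-x / μ) * ∫ y in Iic x, Real.exp (y / μ) * r y

section expAverage

variable {μ : ℝ} {r r₁ r₂ : ℝ → ℝ}

theorem integrableOn_exp_mul (hμ : 0 < μ) (hr : Integrable r volume) (x : ℝ) :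
    IntegrableOn (fun y => Real.exp (y / μ) * r y) (Iic x) volume := by
  refine Integrable.mono' ((hr.norm.const_mul (Real.exp (x / μ))).integrableOn)
    ((by fun_prop : Continuous fun y => Real.exp (y / μ)).aestronglyMeasurable.mul hr.1).restrict ?_
  refine (ae_restrict_iff' measurableSet_Iic).2 (Eventually.of_forall fun y hy => ?_)
  rw [norm_mul, Real.norm_of_nonneg (Real.exp_pos _).le]
  have : y ≤ x := hy
  gcongr

theorem expAverage_sub (hμ : 0 < μ) (h₁ : Integrable r₁ volume) (h₂ : Integrable r₂ volume)
    (x : ℝ) :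
    expAverage μ r₁ x - expAverage μ r₂ x = expAverage μ (fun y => r₁ y - r₂ y) x := by
  unfold expAverage
  rw [← mul_sub, ← integral_sub (integrableOn_exp_mul hμ h₁ x) (integrableOn_exp_mul hμ h₂ x)]
  simp only [mul_sub]

theorem isPrimitive_expAverage (hμ : 0 < μ) (hr : Integrable r volume) :
    IsPrimitive (expAverage μ r) fun x => r x - expAverage μ r x / μ := by
  have h1 : IsPrimitive (fun x => Real.exp (-x / μ)) fun x => -(Real.exp (-x / μ) / μ) := by
    have h := IsPrimitive.of_contDiff (G := fun x => Real.exp (-x / μ)) (by fun_prop)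
    convert h using 2 with x
    have h2 : HasDerivAt (fun x : ℝ => -x / μ) (-1 / μ) x := (hasDerivAt_neg x).div_const μ
    rw [h2.exp.deriv]
    ring
  have h2 : IsPrimitive (fun x => ∫ y in Iic x, Real.exp (y / μ) * r y)
      fun x => Real.exp (x / μ) * r x :=
    ⟨fun a b => hr.intervalIntegrable.continuousOn_mul (by fun_prop), fun x y =>
      intervalIntegral.integral_Iic_sub_Iic (integrableOn_exp_mul hμ hr _)
        (integrableOn_exp_mul hμ hr _)⟩
  have h3 := h1.mul h2
  change IsPrimitive (expAverage μ r) _ at h3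
  convert h3 using 2 with x
  rw [← mul_assoc, ← Real.exp_add, neg_div, neg_add_cancel, Real.exp_zero, one_mul, expAverage,
    neg_div]
  ring

theorem abs_expAverage_le (x : ℝ) :
    |expAverage μ r x| ≤ expAverage μ (fun y => |r y|) x := by
  unfold expAverage
  rw [abs_mul, abs_of_pos (Real.exp_pos _)]
  gcongr
  refine (abs_integral_le_integral_abs).trans (le_of_eq ?_)
  simp only [abs_mul, abs_of_pos (Real.exp_pos _)]

theorem expAverage_abs_le (hμ : 0 < μ) (hr : Integrable r volume) (x : ℝ) :
    expAverage μ (fun y => |r y|) x ≤ ∫ y, |r y| := by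
  unfold expAverage
  rw [← integral_const_mul]
  refine (setIntegral_mono_on ((integrableOn_exp_mul hμ hr.abs x).const_mul _)
    hr.abs.integrableOn measurableSet_Iic fun y hy => ?_).trans
    (setIntegral_le_integral hr.abs (Eventually.of_forall fun _ => abs_nonneg _))
  have hyx : y ≤ x := hy
  rw [← mul_assoc, ← Real.exp_add]
  refine mul_le_of_le_one_left (abs_nonneg _) (Real.exp_le_one_iff.2 ?_)
  rw [← add_div]
  exact div_nonpos_of_nonpos_of_nonneg (by linarith) hμ.le

/-- Integrate `p' = |r| - p / μ` for the average `p ≥ 0` of `|r|`: the integral of `p / μ` is at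
most that of `|r|` plus `p(a)`, and `p(a)` is again at most the integral of `|r|`. The factor `2` is
harmless, as `κ` is chosen small later. -/
theorem intervalIntegral_abs_expAverage_le (hμ : 0 < μ) (hr : Integrable r volume) {a b : ℝ}
    (hab : a ≤ b) : ∫ x in a..b, |expAverage μ r x| ≤ 2 * μ * ∫ x, |r x| := by
  have hp := isPrimitive_expAverage hμ hr.abs
  have hp0 : ∀ x, 0 ≤ expAverage μ (fun y => |r y|) x := fun x =>
    (abs_nonneg _).trans (abs_expAverage_le x)
  have h1 : ∫ x in a..b, |expAverage μ r x| ≤ ∫ x in a..b, expAverage μ (fun y => |r y|) x :=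
    intervalIntegral.integral_mono_on hab
      ((isPrimitive_expAverage hμ hr).continuous.abs.intervalIntegrable _ _)
      (hp.continuous.intervalIntegrable _ _) fun x _ => abs_expAverage_le x
  have h2 := hp.sub_eq a b
  rw [intervalIntegral.integral_sub hr.abs.intervalIntegrable
    ((hp.continuous.div_const μ).intervalIntegrable _ _), intervalIntegral.integral_div] at h2
  have h3 : ∫ x in a..b, |r x| ≤ ∫ x, |r x| := by
    rw [intervalIntegral.integral_of_le hab]
    exact setIntegral_le_integral hr.abs (Eventually.of_forall fun _ => abs_nonneg _)
  have h4 := expAverage_abs_le hμ hr a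
  have h5 : (∫ x in a..b, expAverage μ (fun y => |r y|) x) / μ ≤ 2 * ∫ x, |r x| := by
    linarith [hp0 b]
  rw [div_le_iff₀ hμ] at h5
  linarith

theorem integrable_expAverage (hμ : 0 < μ) (hr : Integrable r volume) :
    Integrable (expAverage μ r) volume := by
  have hc := (isPrimitive_expAverage hμ hr).continuous
  refine integrable_of_intervalIntegral_norm_bounded (l := atTop) (2 * μ * ∫ x, |r x|)
    (fun i : ℝ => (hc.integrableOn_Icc).mono_set Ioc_subset_Icc_self) tendsto_neg_atTop_atBot
    tendsto_id ?_
  filter_upwards [eventually_ge_atTop 0] with n hn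
  exact intervalIntegral_abs_expAverage_le hμ hr (by simp only [id]; linarith)

theorem integral_abs_expAverage_le (hμ : 0 < μ) (hr : Integrable r volume) :
    ∫ x, |expAverage μ r x| ≤ 2 * μ * ∫ x, |r x| := by
  refine le_of_tendsto (intervalIntegral_tendsto_integral (integrable_expAverage hμ hr).abs
    tendsto_neg_atTop_atBot tendsto_id) ?_
  filter_upwards [eventually_ge_atTop 0] with n hn
  exact intervalIntegral_abs_expAverage_le hμ hr (by simp only [id]; linarith)

end expAverage

/-- Solution operators of the linear system `ε v' = h - F`, `ε κ² F' = w - v`. -/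
theorem exists_linear_solution {κ ε : ℝ} (hκ : 0 < κ) (hε : 0 < ε) {w : ℝ → ℝ}
    (hw : Integrable w volume) :
    ∃ V Φ : (ℝ → ℝ) → ℝ → ℝ,
      (∀ h, Integrable h volume → Integrable (V h) volume ∧
        IsPrimitive (Φ h) (fun x => (w x - V h x) / (ε * κ ^ 2)) ∧
        IsPrimitive (V h) (fun x => (h x - Φ h x) / ε)) ∧
      ∀ h₁ h₂, Integrable h₁ volume → Integrable h₂ volume →
        ∫ x, |V h₁ x - V h₂ x| ≤ 2 * κ * ∫ x, |h₁ x - h₂ x| := by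
  -- The combinations `V + κ Φ` and `V - κ Φ` decouple the system. The first decays to the right and
  -- is averaged from the left with source `rp`; the second is treated after reflection, with source
  -- `rm`.
  set μ := ε * κ with hμdef
  have hμ : 0 < μ := by positivity
  let rp : (ℝ → ℝ) → ℝ → ℝ := fun h x => h x / ε + w x / μ
  let rm : (ℝ → ℝ) → ℝ → ℝ := fun h x => w (-x) / μ - h (-x) / ε
  have hrp : ∀ h, Integrable h volume → Integrable (rp h) volume := fun h hh =>
    (hh.div_const _).add (hw.div_const _)
  have hrm : ∀ h, Integrable h volume → Integrable (rm h) volume := fun h hh =>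
    (hw.comp_neg.div_const _).sub (hh.comp_neg.div_const _)
  refine ⟨fun h x => 1 / 2 * (expAverage μ (rp h) x + expAverage μ (rm h) (-x)),
    fun h x => 1 / (2 * κ) * (expAverage μ (rp h) x - expAverage μ (rm h) (-x)),
    fun h hh => ⟨?_, ?_, ?_⟩, fun h₁ h₂ hh₁ hh₂ => ?_⟩
  · exact ((integrable_expAverage hμ (hrp h hh)).add
      (integrable_expAverage hμ (hrm h hh)).comp_neg).const_mul _
  · convert ((isPrimitive_expAverage hμ (hrp h hh)).sub
      (isPrimitive_expAverage hμ (hrm h hh)).comp_neg).const_mul (1 / (2 * κ)) using 2 with x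
    simp only [rp, rm, neg_neg, hμdef]
    field_simp
    ring
  · convert ((isPrimitive_expAverage hμ (hrp h hh)).add
      (isPrimitive_expAverage hμ (hrm h hh)).comp_neg).const_mul (1 / 2) using 2 with x
    simp only [rp, rm, neg_neg, hμdef]
    field_simp
    ring
  · have hp := integrable_expAverage hμ ((hrp h₁ hh₁).sub (hrp h₂ hh₂))
    have hm := integrable_expAverage hμ ((hrm h₁ hh₁).sub (hrm h₂ hh₂))
    have h1 := integral_abs_expAverage_le hμ ((hrp h₁ hh₁).sub (hrp h₂ hh₂))
    have h2 := integral_abs_expAverage_le hμ ((hrm h₁ hh₁).sub (hrm h₂ hh₂))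
    have e1 : ∫ x, |(rp h₁ - rp h₂) x| = (∫ x, |h₁ x - h₂ x|) / ε := by
      rw [← integral_div]
      congr 1
      ext x
      simp only [Pi.sub_apply, rp]
      rw [add_sub_add_right_eq_sub, ← sub_div, abs_div, abs_of_pos hε]
    have e2 : ∫ x, |(rm h₁ - rm h₂) x| = (∫ x, |h₁ x - h₂ x|) / ε := by
      rw [← integral_div, ← integral_neg_eq_self]
      congr 1
      ext x
      simp only [Pi.sub_apply, rm, neg_neg]
      rw [sub_sub_sub_cancel_left, ← sub_div, abs_div, abs_of_pos hε, abs_sub_comm]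
    rw [e1] at h1
    rw [e2, ← integral_neg_eq_self] at h2
    have h3 : ∫ x, |1 / 2 * (expAverage μ (rp h₁) x + expAverage μ (rm h₁) (-x)) -
        1 / 2 * (expAverage μ (rp h₂) x + expAverage μ (rm h₂) (-x))| ≤
        ∫ x, (1 / 2 * |expAverage μ (rp h₁ - rp h₂) x| +
          1 / 2 * |expAverage μ (rm h₁ - rm h₂) (-x)|) := by
      refine integral_mono_of_nonneg (Eventually.of_forall fun _ => abs_nonneg _)
        ((hp.abs.const_mul _).add (hm.comp_neg.abs.const_mul _)) (Eventually.of_forall fun x => ?_)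
      have a1 := expAverage_sub hμ (hrp h₁ hh₁) (hrp h₂ hh₂) x
      have a2 := expAverage_sub hμ (hrm h₁ hh₁) (hrm h₂ hh₂) (-x)
      change |_| ≤ 1 / 2 * |expAverage μ (fun y => rp h₁ y - rp h₂ y) x| +
          1 / 2 * |expAverage μ (fun y => rm h₁ y - rm h₂ y) (-x)|
      rw [← a1, ← a2]
      refine le_trans (le_of_eq ?_) ((abs_add_le (1 / 2 * (expAverage μ (rp h₁) x -
        expAverage μ (rp h₂) x)) (1 / 2 * (expAverage μ (rm h₁) (-x) -
        expAverage μ (rm h₂) (-x)))).trans (le_of_eq ?_))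
      · congr 1
        ring
      · rw [abs_mul, abs_mul, abs_of_pos (by norm_num : (0 : ℝ) < 1 / 2)]
    rw [integral_add (hp.abs.const_mul _) (hm.comp_neg.abs.const_mul _), integral_const_mul,
      integral_const_mul] at h3
    have h4 : 2 * μ * ((∫ x, |h₁ x - h₂ x|) / ε) = 2 * κ * ∫ x, |h₁ x - h₂ x| := by
      rw [hμdef]
      field_simp
    rw [h4] at h1 h2
    linarith

/-- Banach's fixed point theorem in `L¹(ℝ)`. -/
theorem exists_ae_fixedPoint {T : (ℝ → ℝ) → ℝ → ℝ} {K : ℝ} (hK1 : K < 1)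
    (hT : ∀ z, Integrable z volume → Integrable (T z) volume)
    (hK : ∀ z₁ z₂, Integrable z₁ volume → Integrable z₂ volume →
      ∫ x, |T z₁ x - T z₂ x| ≤ K * ∫ x, |z₁ x - z₂ x|) :
    ∃ z, Integrable z volume ∧ T z =ᵐ[volume] z := by
  -- Evaluating `T` on the chosen representative of a class avoids any requirement that `T` respect
  -- almost everywhere equality; the fixed point is accordingly obtained only almost everywhere.
  let T' : (ℝ →₁[volume] ℝ) → (ℝ →₁[volume] ℝ) := fun z =>
    (hT z (L1.integrable_coeFn z)).toL1 (T z)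
  have hdist : ∀ z₁ z₂ : ℝ →₁[volume] ℝ, dist z₁ z₂ = ∫ x, |z₁ x - z₂ x| := fun z₁ z₂ => by
    rw [dist_eq_norm, L1.norm_eq_integral_norm]
    exact integral_congr_ae (by
      filter_upwards [Lp.coeFn_sub z₁ z₂] with x hx
      rw [hx, Pi.sub_apply, Real.norm_eq_abs])
  have hc : ContractingWith K.toNNReal T' := by
    refine ⟨by simpa using hK1, LipschitzWith.of_dist_le_mul fun z₁ z₂ => ?_⟩
    rw [hdist, hdist]
    have h1 := hK z₁ z₂ (L1.integrable_coeFn z₁) (L1.integrable_coeFn z₂)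
    have h2 : ∫ x, |T' z₁ x - T' z₂ x| = ∫ x, |T z₁ x - T z₂ x| :=
      integral_congr_ae (by
        filter_upwards [(hT z₁ (L1.integrable_coeFn z₁)).coeFn_toL1,
          (hT z₂ (L1.integrable_coeFn z₂)).coeFn_toL1] with x h1 h2
        rw [h1, h2])
    rw [h2]
    exact h1.trans (mul_le_mul_of_nonneg_right (Real.le_coe_toNNReal K)
      (integral_nonneg fun _ => abs_nonneg _))
  let z := hc.fixedPoint T'
  have hz : T' z = z := hc.fixedPoint_isFixedPt
  refine ⟨z, L1.integrable_coeFn z, ?_⟩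
  have h1 := (hT z (L1.integrable_coeFn z)).coeFn_toL1
  change T' z =ᵐ[volume] T z at h1
  rw [hz] at h1
  exact h1.symm

namespace ResolventPair

variable {f : ℝ → ℝ → ℝ} {fl fr : ℝ → ℝ} {lam ε : ℝ} {w : ℝ → ℝ}

/-- Freeze the nonlinear term as the source `f(x, z)` of the linear problem. The map sending `z` to
the linear solution has Lipschitz constant `2 κ L` in `L¹`, where `λ = ε κ²`. -/
theorem exists_of_small (hf : FluxF1 f fl fr) {L κ : ℝ}
    (hL : ∀ x y₁ y₂ : ℝ, |f x y₁ - f x y₂| ≤ L * |y₁ - y₂|) (hκ : 0 < κ) (hκL : 2 * κ * L < 1)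
    (hε : 0 < ε) (hw : Integrable w volume) :
    ∃ v F, ResolventPair f (ε * κ ^ 2) ε w v F := by
  obtain ⟨V, Φ, hV, hVK⟩ := exists_linear_solution hκ hε hw
  obtain ⟨z, hz, hfix⟩ := exists_ae_fixedPoint (T := fun z => V fun x => f x (z x)) hκL
    (fun z hz => (hV _ (hf.integrable_comp hz)).1) fun z₁ z₂ h₁ h₂ => by
      refine (hVK _ _ (hf.integrable_comp h₁) (hf.integrable_comp h₂)).trans ?_
      rw [mul_assoc (2 * κ), ← integral_const_mul L]
      refine mul_le_mul_of_nonneg_left (integral_mono_of_nonneg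
        (Eventually.of_forall fun _ => abs_nonneg _) ((h₁.sub h₂).abs.const_mul L)
        (Eventually.of_forall fun x => hL _ _ _)) (by positivity)
  obtain ⟨h1, h2, h3⟩ := hV _ (hf.integrable_comp hz)
  refine ⟨V fun x => f x (z x), Φ fun x => f x (z x), h1, h2, h3.congr_ae ?_⟩
  filter_upwards [hfix] with x hx
  rw [hx]

/-- The resolvent identity `J_λ w = J_λ₀ (θ w + (1 - θ) J_λ w)` with `θ = λ₀ / λ` presents the
solution for `λ` as a fixed point. As `J_λ₀` does not expand `L¹` distances, the map contracts by `1
- θ`. -/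
theorem exists_pair (hf : FluxF1 f fl fr) (hlam : 0 < lam) (hε : 0 < ε)
    (hw : Integrable w volume) : ∃ v F, ResolventPair f lam ε w v F := by
  obtain ⟨L, hL0, hL⟩ := hf.f0.lipschitz
  obtain ⟨κ, hκ, hκL, hκlam⟩ : ∃ κ : ℝ, 0 < κ ∧ 2 * κ * L < 1 ∧ ε * κ ^ 2 ≤ lam := by
    -- The first entry ensures `2 κ L < 1`, the second `λ₀ = ε κ² ≤ λ`, that is `θ ≤ 1`.
    refine ⟨min (1 / (4 * (L + 1))) √(lam / ε), by positivity, ?_, ?_⟩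
    · have h1 : min (1 / (4 * (L + 1))) √(lam / ε) * (4 * (L + 1)) ≤ 1 := by
        rw [← le_div_iff₀ (by positivity)]
        exact min_le_left _ _
      have h2 : 0 < min (1 / (4 * (L + 1))) √(lam / ε) := by positivity
      nlinarith
    · have h1 : min (1 / (4 * (L + 1))) √(lam / ε) ^ 2 ≤ √(lam / ε) ^ 2 :=
        pow_le_pow_left₀ (by positivity) (min_le_right _ _) 2
      rw [Real.sq_sqrt (by positivity), le_div_iff₀ hε] at h1
      linarith
  set lam0 := ε * κ ^ 2 with hlam0
  have hlam0p : 0 < lam0 := by positivity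
  set θ := lam0 / lam with hθ
  have hθ0 : 0 < θ := by positivity
  have hθ1 : θ ≤ 1 := (div_le_one hlam).2 hκlam
  have hrhs : ∀ z, Integrable z volume → Integrable (fun x => θ * w x + (1 - θ) * z x) volume :=
    fun z hz => (hw.const_mul _).add (hz.const_mul _)
  have hex : ∀ z : ℝ → ℝ, ∃ p : (ℝ → ℝ) × (ℝ → ℝ), Integrable z volume →
      ResolventPair f lam0 ε (fun x => θ * w x + (1 - θ) * z x) p.1 p.2 := fun z => by
    by_cases hz : Integrable z volume
    · obtain ⟨v, F, h⟩ := exists_of_small hf hL hκ hκL hε (hrhs z hz)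
      exact ⟨(v, F), fun _ => h⟩
    · exact ⟨(0, 0), fun h => absurd h hz⟩
  choose P hP using hex
  obtain ⟨z, hz, hfix⟩ := exists_ae_fixedPoint (T := fun z => (P z).1) (K := 1 - θ) (by linarith)
    (fun z hz => (hP z hz).integrable) fun z₁ z₂ h₁ h₂ => by
      refine (integral_abs_sub_le hf hlam0p hε (hrhs _ h₁) (hrhs _ h₂) (hP z₁ h₁)
        (hP z₂ h₂)).trans (le_of_eq ?_)
      rw [← integral_const_mul]
      congr 1
      ext x
      rw [add_sub_add_left_eq_sub, ← mul_sub, abs_mul, abs_of_nonneg (by linarith)]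
  refine ⟨(P z).1, (P z).2, (hP z hz).integrable, (hP z hz).flux.congr_ae ?_, (hP z hz).profile⟩
  filter_upwards [hfix] with x hx
  rw [hx, hθ]
  field_simp
  ring

end ResolventPair

/-! ### Weak solutions and the first order system -/

theorem HasCompactSupport.exists_eq_zero_of_le_abs {φ : ℝ → ℝ} (hφ : HasCompactSupport φ) :
    ∃ r : ℝ, 0 < r ∧ ∀ x, r ≤ |x| → φ x = 0 := by
  obtain ⟨r, hr0, hr⟩ := hφ.isCompact.isBounded.subset_ball_lt 0 0
  refine ⟨r, hr0, fun x hx => ?_⟩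
  by_contra hne
  have := hr (subset_tsupport _ hne)
  rw [Metric.mem_ball, dist_zero_right, Real.norm_eq_abs] at this
  linarith

theorem hasCompactSupport_of_eq_zero {φ : ℝ → ℝ} {r : ℝ} (h : ∀ x, r ≤ |x| → φ x = 0) :
    HasCompactSupport φ :=
  HasCompactSupport.intro (isCompact_closedBall (0 : ℝ) r) fun x hx => h x (by
    rw [Metric.mem_closedBall, dist_zero_right, Real.norm_eq_abs, not_le] at hx
    exact hx.le)

theorem integral_eq_intervalIntegral_of_eq_zero {g : ℝ → ℝ} {r : ℝ} (hr : 0 ≤ r)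
    (h : ∀ x, r ≤ |x| → g x = 0) : ∫ x, g x = ∫ x in (-r)..r, g x := by
  rw [intervalIntegral.integral_of_le (by linarith), setIntegral_eq_integral_of_forall_compl_eq_zero]
  intro x hx
  refine h x ?_
  by_contra hlt
  have := abs_lt.1 (not_le.1 hlt)
  exact hx ⟨this.1, this.2.le⟩

theorem IsPrimitive.integral_eq_zero {G g : ℝ → ℝ} (h : IsPrimitive G g)
    (hG : HasCompactSupport G) (hg : HasCompactSupport g) : ∫ x, g x = 0 := by
  obtain ⟨r, hr, hr'⟩ := hG.exists_eq_zero_of_le_abs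
  obtain ⟨s, hs, hs'⟩ := hg.exists_eq_zero_of_le_abs
  have hm : 0 < max r s := lt_max_of_lt_left hr
  rw [integral_eq_intervalIntegral_of_eq_zero hm.le fun x hx =>
    hs' x ((le_max_right _ _).trans hx), ← h.sub_eq, hr' _ (by
      rw [abs_of_pos hm]; exact le_max_left _ _), hr' _ (by
      rw [abs_neg, abs_of_pos hm]; exact le_max_left _ _), sub_zero]

/-- Integration by parts against a compactly supported test function. -/
theorem IsPrimitive.integral_mul_test {G g φ : ℝ → ℝ} (h : IsPrimitive G g)
    (hφ : ContDiff ℝ 1 φ) (hφc : HasCompactSupport φ) :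
    ∫ x, g x * φ x = -∫ x, G x * deriv φ x := by
  have h1 := (h.mul (IsPrimitive.of_contDiff hφ)).integral_eq_zero hφc.mul_left
    (hφc.mul_left.add hφc.deriv.mul_left)
  rw [integral_add] at h1
  · linarith
  · simpa [mul_comm] using
      h.locallyIntegrable.integrable_smul_left_of_hasCompactSupport hφ.continuous hφc
  · exact (h.continuous.mul (hφ.continuous_deriv le_rfl)).integrable_of_hasCompactSupport
      hφc.deriv.mul_left

theorem MeasureTheory.LocallyIntegrable.integrable_mul_test {g φ : ℝ → ℝ}
    (hg : LocallyIntegrable g volume) (hφ : Continuous φ) (hφc : HasCompactSupport φ) :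
    Integrable (fun x => g x * φ x) volume := by
  simpa [mul_comm] using hg.integrable_smul_left_of_hasCompactSupport hφ hφc

theorem exists_test_primitive {ψ : ℝ → ℝ} (hψ : ContDiff ℝ ∞ ψ) (hψc : HasCompactSupport ψ)
    (h0 : ∫ x, ψ x = 0) :
    ∃ φ : ℝ → ℝ, ContDiff ℝ ∞ φ ∧ HasCompactSupport φ ∧ deriv φ = ψ := by
  obtain ⟨r, hr, hr'⟩ := hψc.exists_eq_zero_of_le_abs
  have hderiv : ∀ x, HasDerivAt (fun x => ∫ t in (-r)..x, ψ t) (ψ x) x := fun x =>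
    intervalIntegral.integral_hasDerivAt_right (hψ.continuous.intervalIntegrable _ _)
      (hψ.continuous.stronglyMeasurableAtFilter _ _) hψ.continuous.continuousAt
  have hd : deriv (fun x => ∫ t in (-r)..x, ψ t) = ψ := funext fun x => (hderiv x).deriv
  refine ⟨fun x => ∫ t in (-r)..x, ψ t, ?_, hasCompactSupport_of_eq_zero (r := r) ?_, hd⟩
  · rw [contDiff_infty_iff_deriv, hd]
    exact ⟨fun x => (hderiv x).differentiableAt, hψ⟩
  · intro x hx
    rcases le_abs.1 hx with hx | hx
    · have h1 : ∫ t in r..x, ψ t = 0 := by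
        rw [intervalIntegral.integral_congr (g := fun _ => 0), intervalIntegral.integral_zero]
        intro t ht
        rw [uIcc_of_le hx] at ht
        exact hr' t (ht.1.trans (le_abs_self t))
      rw [← intervalIntegral.integral_add_adjacent_intervals
        (hψ.continuous.intervalIntegrable _ r) (hψ.continuous.intervalIntegrable _ _), h1,
        ← integral_eq_intervalIntegral_of_eq_zero hr.le hr', h0, add_zero]
    · rw [intervalIntegral.integral_congr (g := fun _ => 0), intervalIntegral.integral_zero]
      intro t ht
      rw [uIcc_of_ge (by linarith)] at ht
      exact hr' t ((by linarith [ht.2] : r ≤ -t).trans (neg_le_abs t))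

theorem exists_test_integral_one :
    ∃ ρ : ℝ → ℝ, ContDiff ℝ ∞ ρ ∧ HasCompactSupport ρ ∧ ∫ x, ρ x = 1 := by
  let b : ContDiffBump (0 : ℝ) := ⟨1, 2, one_pos, one_lt_two⟩
  exact ⟨b.normed volume, b.contDiff_normed, b.hasCompactSupport_normed, b.integral_normed⟩

/-- The du Bois-Reymond lemma. -/
theorem exists_ae_eq_const_of_integral_mul_deriv {h : ℝ → ℝ} (hh : LocallyIntegrable h volume)
    (H : ∀ φ : ℝ → ℝ, ContDiff ℝ ∞ φ → HasCompactSupport φ → ∫ x, h x * deriv φ x = 0) :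
    ∃ c : ℝ, ∀ᵐ x, h x = c := by
  obtain ⟨ρ, hρ, hρc, hρ1⟩ := exists_test_integral_one
  refine ⟨∫ x, h x * ρ x, ?_⟩
  refine ae_eq_of_integral_contDiff_smul_eq hh (locallyIntegrable_const _) fun ψ hψ hψc => ?_
  have hψi : Integrable ψ volume := hψ.continuous.integrable_of_hasCompactSupport hψc
  have hρi : Integrable ρ volume := hρ.continuous.integrable_of_hasCompactSupport hρc
  -- Subtracting a multiple of the bump `ρ` gives `ψ` mean zero, hence makes it the derivative of a
  -- test function.
  obtain ⟨φ, hφ, hφc, hφd⟩ := exists_test_primitive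
    (ψ := fun x => ψ x - (∫ y, ψ y) * ρ x) (hψ.sub (contDiff_const.mul hρ))
    (hψc.sub hρc.mul_left) (by
      rw [integral_sub hψi (hρi.const_mul _), integral_const_mul, hρ1, mul_one, sub_self])
  have h1 := H φ hφ hφc
  rw [hφd] at h1
  have h2 : ∫ x, h x * (ψ x - (∫ y, ψ y) * ρ x) =
      (∫ x, h x * ψ x) - (∫ y, ψ y) * ∫ x, h x * ρ x := by
    rw [← integral_const_mul, ← integral_sub (hh.integrable_mul_test hψ.continuous hψc)
      ((hh.integrable_mul_test hρ.continuous hρc).const_mul _)]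
    congr 1
    ext x
    ring
  simp only [smul_eq_mul]
  rw [integral_mul_const]
  simp only [mul_comm (ψ _)]
  linarith

/-- The second order du Bois-Reymond lemma. -/
theorem exists_ae_eq_affine_of_integral_mul_deriv {h : ℝ → ℝ} (hh : LocallyIntegrable h volume)
    (H : ∀ φ : ℝ → ℝ, ContDiff ℝ ∞ φ → HasCompactSupport φ →
      ∫ x, h x * deriv (deriv φ) x = 0) :
    ∃ c k : ℝ, ∀ᵐ x, h x = c + k * x := by
  obtain ⟨ρ, hρ, hρc, hρ1⟩ := exists_test_integral_one
  set k := ∫ x, h x * deriv ρ x with hk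
  have hid : LocallyIntegrable (fun x : ℝ => k * x) volume :=
    (continuous_const.mul continuous_id).locallyIntegrable
  -- Applying the hypothesis to a primitive of the mean-zero part of `ψ` shows that `h` has
  -- distributional derivative `-k`; the first order lemma then applies to `h + k x`.
  have hkey : ∀ ψ : ℝ → ℝ, ContDiff ℝ ∞ ψ → HasCompactSupport ψ →
      ∫ x, (h x + k * x) * deriv ψ x = 0 := by
    intro ψ hψ hψc
    have hψi : Integrable ψ volume := hψ.continuous.integrable_of_hasCompactSupport hψc
    have hρi : Integrable ρ volume := hρ.continuous.integrable_of_hasCompactSupport hρc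
    have hψd : Continuous (deriv ψ) := hψ.continuous_deriv (by simp)
    have hρd : Continuous (deriv ρ) := hρ.continuous_deriv (by simp)
    obtain ⟨φ, hφ, hφc, hφd⟩ := exists_test_primitive
      (ψ := fun x => ψ x - (∫ y, ψ y) * ρ x) (hψ.sub (contDiff_const.mul hρ))
      (hψc.sub hρc.mul_left) (by
        rw [integral_sub hψi (hρi.const_mul _), integral_const_mul, hρ1, mul_one, sub_self])
    have h1 := H φ hφ hφc
    have hdd : deriv (deriv φ) = fun x => deriv ψ x - (∫ y, ψ y) * deriv ρ x := by
      rw [hφd]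
      ext x
      exact (((hψ.differentiable (by simp) x).hasDerivAt).sub
        (((hρ.differentiable (by simp) x).hasDerivAt).const_mul _)).deriv
    rw [hdd] at h1
    have h2 : ∫ x, h x * (deriv ψ x - (∫ y, ψ y) * deriv ρ x) =
        (∫ x, h x * deriv ψ x) - (∫ y, ψ y) * k := by
      rw [hk, ← integral_const_mul, ← integral_sub (hh.integrable_mul_test hψd hψc.deriv)
        ((hh.integrable_mul_test hρd hρc.deriv).const_mul _)]
      congr 1
      ext x
      ring
    have h3 := (IsPrimitive.of_contDiff (G := fun x : ℝ => k * x) (by fun_prop)).integral_mul_test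
      (hψ.of_le (by simp)) hψc
    have hdk : deriv (fun x : ℝ => k * x) = fun _ => k := by
      ext x
      simp
    rw [hdk, integral_const_mul] at h3
    simp only [add_mul]
    rw [integral_add (hh.integrable_mul_test hψd hψc.deriv)
      (hid.integrable_mul_test hψd hψc.deriv)]
    linarith
  obtain ⟨c, hc⟩ := exists_ae_eq_const_of_integral_mul_deriv (hh.add hid) hkey
  refine ⟨c, -k, ?_⟩
  filter_upwards [hc] with x hx
  have : h x + k * x = c := hx
  linarith

namespace ResolventPair

variable {f : ℝ → ℝ → ℝ} {fl fr : ℝ → ℝ} {lam ε : ℝ} {w v F u : ℝ → ℝ}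

/-- The function `F φ + ε v φ'` has compact support, so its derivative integrates to zero; in that
derivative the two occurrences of `F φ'` cancel. -/
theorem isWeakSolution (hε : 0 < ε) (h : ResolventPair f lam ε w v F) :
    IsWeakSolution f lam ε w v := by
  refine ⟨h.integrable.locallyIntegrable, fun φ hφ hφc => ?_⟩
  have hφ1 : ContDiff ℝ 1 φ := hφ.of_le one_le_two
  have hφd : ContDiff ℝ 1 (deriv φ) := by
    have : ContDiff ℝ (1 + 1) φ := by simpa [one_add_one_eq_two] using hφ
    exact (contDiff_succ_iff_deriv.1 this).2.2
  have h1 := (h.flux.mul (IsPrimitive.of_contDiff hφ1)).add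
    ((h.profile.mul (IsPrimitive.of_contDiff hφd)).const_mul ε)
  have h2 := h1.integral_eq_zero (hφc.mul_left.add hφc.deriv.mul_left.mul_left)
    ((hφc.mul_left.add hφc.deriv.mul_left).add
      (hφc.deriv.mul_left.add hφc.deriv.deriv.mul_left).mul_left)
  rw [← neg_eq_zero, ← integral_neg, ← h2]
  congr 1
  ext x
  rw [iteratedDeriv_succ, iteratedDeriv_one]
  field_simp
  ring

theorem isViscousResolvent (hε : 0 < ε) (h : ResolventPair f lam ε w v F) :
    IsViscousResolvent f lam ε w v :=
  ⟨h.profile.continuous, h.integrable, h.isWeakSolution hε⟩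

/-- With `P` a primitive of `(w - u) / λ` and `Q` one of `f(x, u) - P`, the weak equation says that
`Q - ε u` has zero second derivative, so it is affine, `c + k x`. Solving for `u` gives the
continuous representative, and the total flux is `P + k`. -/
theorem exists_of_isWeakSolution (hf : FluxF1 f fl fr) (hε : 0 < ε)
    (hw : Integrable w volume) (hu : Integrable u volume) (h : IsWeakSolution f lam ε w u) :
    ∃ v F, u =ᵐ[volume] v ∧ ResolventPair f lam ε w v F := by
  have hg : Integrable (fun x => (w x - u x) / lam) volume := (hw.sub hu).div_const _
  have hfu := hf.integrable_comp hu
  have hP := IsPrimitive.integral hg.locallyIntegrable.intervalIntegrable_real 0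
  set P := fun x => ∫ t in (0 : ℝ)..x, (w t - u t) / lam with hPdef
  have hQ := IsPrimitive.integral (g := fun x => f x (u x) - P x)
    (fun a b => hfu.intervalIntegrable.sub (hP.continuous.intervalIntegrable a b)) 0
  set Q := fun x => ∫ t in (0 : ℝ)..x, (f t (u t) - P t) with hQdef
  have hQu : LocallyIntegrable (fun x => Q x - ε * u x) volume :=
    hQ.continuous.locallyIntegrable.sub (hu.const_mul ε).locallyIntegrable
  obtain ⟨c, k, hck⟩ := exists_ae_eq_affine_of_integral_mul_deriv hQu fun φ hφ hφc => by
    have hφ1 : ContDiff ℝ 1 φ := hφ.of_le (by simp)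
    have hφd : ContDiff ℝ ∞ (deriv φ) := (contDiff_infty_iff_deriv.1 hφ).2
    have hφd1 : ContDiff ℝ 1 (deriv φ) := hφd.of_le (by simp)
    have hφdd : Continuous (deriv (deriv φ)) := hφd1.continuous_deriv le_rfl
    have h1 := h.2 φ (contDiff_infty.1 hφ 2) hφc
    have h2 := hP.integral_mul_test hφ1 hφc
    have h3 := hQ.integral_mul_test hφd1 hφc.deriv
    simp only [iteratedDeriv_succ, iteratedDeriv_zero] at h1
    have i1 : Integrable (fun x => (w x - u x) / lam * φ x) volume :=
      hg.locallyIntegrable.integrable_mul_test hφ.continuous hφc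
    have i2 : Integrable (fun x => f x (u x) * deriv φ x) volume :=
      hfu.locallyIntegrable.integrable_mul_test hφd.continuous hφc.deriv
    have i3 : Integrable (fun x => ε * u x * deriv (deriv φ) x) volume :=
      (hu.const_mul ε).locallyIntegrable.integrable_mul_test hφdd hφc.deriv.deriv
    have i4 : Integrable (fun x => P x * deriv φ x) volume :=
      hP.continuous.locallyIntegrable.integrable_mul_test hφd.continuous hφc.deriv
    have i5 : Integrable (fun x => Q x * deriv (deriv φ) x) volume :=
      hQ.continuous.locallyIntegrable.integrable_mul_test hφdd hφc.deriv.deriv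
    have e1 : ∫ x, ((u x - w x) / lam * φ x - f x (u x) * deriv φ x
        - ε * u x * deriv (deriv φ) x) =
        -((∫ x, (w x - u x) / lam * φ x) + (∫ x, f x (u x) * deriv φ x)
        + ∫ x, ε * u x * deriv (deriv φ) x) := by
      have i12 : Integrable (fun x => (w x - u x) / lam * φ x + f x (u x) * deriv φ x) volume :=
        i1.add i2
      rw [← integral_add i1 i2, ← integral_add i12 i3, ← integral_neg]
      congr 1
      ext x
      ring
    have e2 : ∫ x, (f x (u x) - P x) * deriv φ x =
        (∫ x, f x (u x) * deriv φ x) - ∫ x, P x * deriv φ x := by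
      rw [← integral_sub i2 i4]
      congr 1
      ext x
      ring
    have e3 : ∫ x, (Q x - ε * u x) * deriv (deriv φ) x =
        (∫ x, Q x * deriv (deriv φ) x) - ∫ x, ε * u x * deriv (deriv φ) x := by
      rw [← integral_sub i5 i3]
      congr 1
      ext x
      ring
    rw [e1] at h1
    rw [e2] at h3
    rw [e3]
    linarith
  have hae : u =ᵐ[volume] fun x => 1 / ε * (Q x - (c + k * x)) := by
    filter_upwards [hck] with x hx
    rw [← hx]
    field_simp
    ring
  have hkx : IsPrimitive (fun x : ℝ => c + k * x) fun _ => k := by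
    have := IsPrimitive.of_contDiff (G := fun x : ℝ => c + k * x) (by fun_prop)
    convert this using 2 with x
    simp
  refine ⟨fun x => 1 / ε * (Q x - (c + k * x)), fun x => P x + k, hae, hu.congr hae, ?_, ?_⟩
  · have h1 := hP.add (IsPrimitive.const k)
    refine h1.congr_ae ?_
    filter_upwards [hae] with x hx
    rw [← hx, add_zero]
  · refine ((hQ.sub hkx).const_mul (1 / ε)).congr_ae ?_
    filter_upwards [hae] with x hx
    rw [← hx]
    ring

end ResolventPair

section viscousResolvent

variable {f : ℝ → ℝ → ℝ} {fl fr : ℝ → ℝ} {lam ε : ℝ} {w : ℝ → ℝ}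

theorem isViscousResolvent_viscousResolvent (hf : FluxF1 f fl fr) (hlam : 0 < lam) (hε : 0 < ε)
    (hw : Integrable w volume) :
    IsViscousResolvent f lam ε w (viscousResolvent f lam ε w) := by
  obtain ⟨v, F, h⟩ := ResolventPair.exists_pair hf hlam hε hw
  exact Classical.epsilon_spec (p := fun u => IsViscousResolvent f lam ε w u)
    ⟨v, h.isViscousResolvent hε⟩

theorem exists_resolventPair_viscousResolvent (hf : FluxF1 f fl fr) (hlam : 0 < lam) (hε : 0 < ε)
    (hw : Integrable w volume) :
    ∃ F, ResolventPair f lam ε w (viscousResolvent f lam ε w) F := by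
  have h := isViscousResolvent_viscousResolvent hf hlam hε hw
  obtain ⟨v, F, hv, hp⟩ :=
    ResolventPair.exists_of_isWeakSolution hf hε hw h.integrable h.weakSolution
  rw [Continuous.ae_eq_iff_eq volume h.continuous hp.profile.continuous] at hv
  exact ⟨F, by rwa [hv]⟩

theorem ae_eq_viscousResolvent (hf : FluxF1 f fl fr) (hlam : 0 < lam) (hε : 0 < ε)
    (hw : Integrable w volume) {v : ℝ → ℝ} (hv : Integrable v volume)
    (h : IsWeakSolution f lam ε w v) : v =ᵐ[volume] viscousResolvent f lam ε w := by
  obtain ⟨F, hp⟩ := exists_resolventPair_viscousResolvent hf hlam hε hw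
  obtain ⟨v', F', hv', hp'⟩ := ResolventPair.exists_of_isWeakSolution hf hε hw hv h
  rwa [ResolventPair.eq_of_eq hf hlam hε hw hp' hp] at hv'

end viscousResolvent

/-! ### Helly selection and functions of bounded variation -/

theorem exists_subseq_tendsto_of_countable {S : Set ℝ} (hS : S.Countable) {h : ℕ → ℝ → ℝ} {C : ℝ}
    (hb : ∀ n x, |h n x| ≤ C) :
    ∃ σ : ℕ → ℕ, StrictMono σ ∧
      ∀ x ∈ S, ∃ l, Tendsto (fun n => h (σ n) x) atTop (𝓝 l) := by
  have : Countable S := hS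
  -- Tychonoff's theorem; countability of `S` makes the product metrizable, hence sequentially
  -- compact.
  have hK : IsCompact (Set.pi univ fun _ : S => Icc (-C) C) :=
    isCompact_univ_pi fun _ => isCompact_Icc
  obtain ⟨l, -, σ, hσ, hl⟩ := hK.tendsto_subseq (x := fun n (s : S) => h n s)
    fun n s _ => abs_le.1 (hb n s)
  exact ⟨σ, hσ, fun x hx => ⟨l ⟨x, hx⟩, (tendsto_pi_nhds.1 hl) ⟨x, hx⟩⟩⟩

/-- **Helly's selection theorem** for uniformly bounded monotone functions. -/
theorem exists_subseq_tendsto_of_monotone {h : ℕ → ℝ → ℝ} {C : ℝ} (hm : ∀ n, Monotone (h n))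
    (hb : ∀ n x, |h n x| ≤ C) :
    ∃ (σ : ℕ → ℕ) (g : ℝ → ℝ), StrictMono σ ∧
      ∀ x, Tendsto (fun n => h (σ n) x) atTop (𝓝 (g x)) := by
  obtain ⟨σ, hσ, hQ⟩ := exists_subseq_tendsto_of_countable (countable_range ((↑) : ℚ → ℝ)) hb
  have hbdd : ∀ x, IsBoundedUnder (· ≤ ·) atTop fun n => h (σ n) x := fun x =>
    isBoundedUnder_of ⟨C, fun n => (abs_le.1 (hb (σ n) x)).2⟩
  have hcob : ∀ x, IsCoboundedUnder (· ≤ ·) atTop fun n => h (σ n) x := fun x =>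
    (isBoundedUnder_of ⟨-C, fun n => (abs_le.1 (hb (σ n) x)).1⟩ :
      IsBoundedUnder (· ≥ ·) atTop fun n => h (σ n) x).isCoboundedUnder_le
  -- The upper limit is a monotone candidate defined everywhere, and on the rationals it is the
  -- limit.
  set H : ℝ → ℝ := fun x => limsup (fun n => h (σ n) x) atTop with hH
  have hHm : Monotone H := fun x y hxy =>
    limsup_le_limsup (Eventually.of_forall fun n => hm (σ n) hxy) (hcob x) (hbdd y)
  have hHQ : ∀ q : ℚ, Tendsto (fun n => h (σ n) q) atTop (𝓝 (H q)) := fun q => by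
    obtain ⟨l, hl⟩ := hQ q ⟨q, rfl⟩
    have : H q = l := hl.limsup_eq
    rwa [this]
  have hcont : ∀ x, ContinuousAt H x → Tendsto (fun n => h (σ n) x) atTop (𝓝 (H x)) := by
    intro x hx
    rw [tendsto_order]
    constructor
    · intro a ha
      obtain ⟨l, u, ⟨hlx, hxu⟩, hsub⟩ := mem_nhds_iff_exists_Ioo_subset.1
        (hx.eventually (lt_mem_nhds ha))
      obtain ⟨q, hq1, hq2⟩ := exists_rat_btwn hlx
      have hq : a < H q := hsub ⟨hq1, by linarith⟩
      filter_upwards [(hHQ q).eventually (lt_mem_nhds hq)] with n hn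
      exact hn.trans_le (hm _ hq2.le)
    · intro a ha
      obtain ⟨l, u, ⟨hlx, hxu⟩, hsub⟩ := mem_nhds_iff_exists_Ioo_subset.1
        (hx.eventually (gt_mem_nhds ha))
      obtain ⟨q, hq1, hq2⟩ := exists_rat_btwn hxu
      have hq : H q < a := hsub ⟨by linarith, hq2⟩
      filter_upwards [(hHQ q).eventually (gt_mem_nhds hq)] with n hn
      exact (hm _ hq1.le).trans_lt hn
  -- The candidate has only countably many discontinuities, so one more diagonal extraction gives
  -- convergence at every point. The value of the final limit at such a point may differ from `H`.
  obtain ⟨τ, hτ, hD⟩ := exists_subseq_tendsto_of_countable hHm.countable_not_continuousAt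
    (h := fun n => h (σ n)) fun n x => hb (σ n) x
  have hall : ∀ x, ∃ l, Tendsto (fun n => h (σ (τ n)) x) atTop (𝓝 l) := fun x => by
    by_cases hx : ContinuousAt H x
    · exact ⟨H x, (hcont x hx).comp hτ.tendsto_atTop⟩
    · exact hD x hx
  choose g hg using hall
  exact ⟨σ ∘ τ, g, hσ.comp hτ, hg⟩

/-- The increasing total variation function of a function of bounded variation. -/
theorem BoundedVariationOn.exists_monotone {v : ℝ → ℝ} (hv : BoundedVariationOn v univ) :
    ∃ (V : ℝ → ℝ) (M : ℝ), Monotone V ∧ (∀ x, 0 ≤ V x ∧ V x ≤ M) ∧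
      ∀ x y, x ≤ y → |v y - v x| ≤ V y - V x := by
  have hfin : ∀ x, eVariationOn v (Iic x) ≠ ⊤ := fun x => hv.mono (subset_univ _)
  have key : ∀ x y, x ≤ y → |v y - v x| ≤
      (eVariationOn v (Iic y)).toReal - (eVariationOn v (Iic x)).toReal := by
    intro x y hxy
    have h1 : eVariationOn v (Iic x) + edist (v y) (v x) ≤ eVariationOn v (Iic y) := by
      calc eVariationOn v (Iic x) + edist (v y) (v x)
          ≤ eVariationOn v (Iic x) + eVariationOn v (Icc x y) := by
            gcongr
            exact eVariationOn.edist_le v (right_mem_Icc.2 hxy) (left_mem_Icc.2 hxy)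
        _ ≤ eVariationOn v (Iic x ∪ Icc x y) :=
            eVariationOn.add_le_union v fun a ha b hb => le_trans ha hb.1
        _ ≤ eVariationOn v (Iic y) := eVariationOn.mono v
            (union_subset (Iic_subset_Iic.2 hxy) Icc_subset_Iic_self)
    have h2 := ENNReal.toReal_mono (hfin y) h1
    rw [ENNReal.toReal_add (hfin x) (edist_ne_top _ _), edist_dist,
      ENNReal.toReal_ofReal dist_nonneg, Real.dist_eq] at h2
    linarith
  refine ⟨fun x => (eVariationOn v (Iic x)).toReal, (eVariationOn v univ).toReal,
    fun x y hxy => ?_, fun x => ⟨ENNReal.toReal_nonneg, ?_⟩, key⟩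
  · have := (abs_nonneg _).trans (key x y hxy)
    simpa using this
  · exact ENNReal.toReal_mono hv (eVariationOn.mono v (subset_univ _))

theorem MemBV.exists_integral_abs_translate_le {w : ℝ → ℝ} (hw : MemBV w) :
    ∃ M : ℝ, 0 ≤ M ∧ ∀ a b h : ℝ, a ≤ b → 0 ≤ h →
      ∫ x in a..b, |w (x + h) - w x| ≤ M * h := by
  obtain ⟨-, v, hvw, hv⟩ := hw
  obtain ⟨V, M, hVm, hVM, hV⟩ := hv.exists_monotone
  refine ⟨M, (hVM 0).1.trans (hVM 0).2, fun a b h hab hh => ?_⟩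
  have hshift : ∀ᵐ x, v (x + h) = w (x + h) :=
    (measurePreserving_add_right volume h).quasiMeasurePreserving.ae hvw
  have h1 : ∫ x in a..b, |w (x + h) - w x| = ∫ x in a..b, |v (x + h) - v x| :=
    intervalIntegral.integral_congr_ae (by
      filter_upwards [hvw, hshift] with x hx hx' _
      rw [hx, hx'])
  have hVi : ∀ c d, IntervalIntegrable V volume c d := fun c d => hVm.intervalIntegrable
  have hVs : IntervalIntegrable (fun x => V (x + h)) volume a b :=
    (hVm.comp fun x y hxy => by simpa using hxy : Monotone fun x => V (x + h)).intervalIntegrable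
  have hvm : AEStronglyMeasurable (fun x => |v (x + h) - v x|) (volume.restrict (uIoc a b)) := by
    have hvmeas : Measurable v :=
      (hv.locallyBoundedVariationOn.exists_monotoneOn_sub_monotoneOn).elim fun p hp =>
        hp.elim fun q hq => by
          have e : v = p - q := hq.2.2
          rw [e]
          exact (monotoneOn_univ.1 hq.1).measurable.sub (monotoneOn_univ.1 hq.2.1).measurable
    exact ((hvmeas.comp (measurable_id.add_const h)).sub hvmeas).abs.aestronglyMeasurable
  have h2 : ∫ x in a..b, |v (x + h) - v x| ≤ ∫ x in a..b, (V (x + h) - V x) := by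
    have hb : ∀ x, |v (x + h) - v x| ≤ V (x + h) - V x := fun x => hV _ _ (by linarith)
    refine intervalIntegral.integral_mono_on hab ?_ (hVs.sub (hVi a b)) fun x _ => hb x
    refine (hVs.sub (hVi a b)).mono_fun hvm (Eventually.of_forall fun x => ?_)
    simp only [Real.norm_eq_abs, abs_abs]
    exact (hb x).trans (le_abs_self _)
  -- The integral of an increment telescopes to two windows of length `h`, on which `0 ≤ V ≤ M`.
  have h3 : ∫ x in a..b, (V (x + h) - V x) =
      (∫ x in b..(b + h), V x) - ∫ x in a..(a + h), V x := by
    rw [intervalIntegral.integral_sub hVs (hVi a b), intervalIntegral.integral_comp_add_right,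
      intervalIntegral.integral_interval_sub_interval_comm (hVi _ _) (hVi _ _) (hVi _ _),
      intervalIntegral.integral_symm a (a + h), intervalIntegral.integral_symm b (b + h)]
    ring
  have h4 : ∫ x in b..(b + h), V x ≤ M * h := by
    have := intervalIntegral.integral_mono_on (by linarith : b ≤ b + h) (hVi _ _)
      (intervalIntegrable_const (c := M)) fun x _ => (hVM x).2
    rw [intervalIntegral.integral_const, smul_eq_mul] at this
    linarith
  have h5 : 0 ≤ ∫ x in a..(a + h), V x :=
    intervalIntegral.integral_nonneg (by linarith) fun x _ => (hVM x).1
  linarith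

/-! ### Variation bounds uniform in the viscosity -/

namespace ResolventPair

variable {f : ℝ → ℝ → ℝ} {fl fr : ℝ → ℝ} {lam ε : ℝ} {w v F : ℝ → ℝ}

theorem abs_flux_sub_le (hlam : 0 < lam) (hw : ∀ᵐ x, 0 ≤ w x ∧ w x ≤ 1)
    (hv : ∀ x, 0 ≤ v x ∧ v x ≤ 1) (h : ResolventPair f lam ε w v F) (x y : ℝ) :
    |F y - F x| ≤ |y - x| / lam := by
  rw [h.flux.sub_eq, div_eq_mul_inv, mul_comm, ← Real.norm_eq_abs]
  refine intervalIntegral.norm_integral_le_of_norm_le_const_ae ?_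
  filter_upwards [hw] with t ht _
  rw [norm_div, Real.norm_of_nonneg hlam.le, Real.norm_eq_abs, div_le_iff₀ hlam,
    inv_mul_cancel₀ hlam.ne', abs_le]
  constructor <;> linarith [ht.1, ht.2, (hv t).1, (hv t).2]

/-- Away from the interface a translate of the solution solves the same system with translated data,
so the Kato estimate bounds `v(x + t) - v(x)`: the data contribute `M t`, and each of the two
boundary terms at most `t` because `λ F` is `1`-Lipschitz. Dividing by `t` and letting `t → 0` gives
`M + 2`. -/
theorem integral_abs_deriv_le_of_side (hf : FluxF1 f fl fr) (hlam : 0 < lam) (hε : 0 < ε)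
    (hwi : Integrable w volume) (hw : ∀ᵐ x, 0 ≤ w x ∧ w x ≤ 1)
    (hv : ∀ x, 0 ≤ v x ∧ v x ≤ 1) {M : ℝ} (hM : ∀ a b h : ℝ, a ≤ b → 0 ≤ h →
      ∫ x in a..b, |w (x + h) - w x| ≤ M * h)
    (h : ResolventPair f lam ε w v F) {a b c : ℝ} (hab : a ≤ b) (hbc : b < c)
    (hside : ∀ x ∈ Icc a c, f x = f a) :
    ∫ x in a..b, |(f x (v x) - F x) / ε| ≤ M + 2 := by
  obtain ⟨L, hL0, hL⟩ := hf.f0.lipschitz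
  have hstep : ∀ t : ℝ, 0 ≤ t → t ≤ c - b → ∫ x in a..b, |v (x + t) - v x| ≤ (M + 2) * t := by
    intro t ht htc
    have key := integral_abs_le_of_isPrimitive (d := fun x => v (x + t) - v x)
      (D := fun x => F (x + t) - F x) (g := fun x => f (x + t) (v (x + t)) - f x (v x))
      (om := fun x => w (x + t) - w x) (L := L) hlam hε hab (by
        convert (h.profile.comp_add_right t).sub h.profile using 2
        ring) (by
        convert (h.flux.comp_add_right t).sub h.flux using 2
        ring) ((hwi.comp_add_right t).intervalIntegrable.sub hwi.intervalIntegrable)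
      fun x hx => by
        rw [hside (x + t) ⟨by linarith [hx.1], by linarith [hx.2]⟩,
          hside x ⟨hx.1, by linarith [hx.2]⟩]
        exact hL _ _ _
    have hD : ∀ x s : ℝ, |s| ≤ 1 → |lam * ((F (x + t) - F x) * s)| ≤ t := fun x s hs => by
      have h1 := h.abs_flux_sub_le hlam hw hv x (x + t)
      rw [add_sub_cancel_left, abs_of_nonneg ht, le_div_iff₀ hlam] at h1
      rw [abs_mul, abs_mul, abs_of_pos hlam]
      have h2 : |F (x + t) - F x| * |s| ≤ |F (x + t) - F x| :=
        mul_le_of_le_one_right (abs_nonneg _) hs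
      nlinarith
    have h1 := hD a _ (abs_div_abs_self_le (v (a + t) - v a))
    have h2 := hD b _ (abs_div_abs_self_le (v (b + t) - v b))
    have h3 := hM a b t hab ht
    rw [mul_sub] at key
    linarith [(abs_le.1 h1).2, (abs_le.1 h2).1]
  obtain ⟨C, hC⟩ := isCompact_Icc.exists_bound_of_continuousOn
    (h.flux.continuous.continuousOn (s := Icc a c))
  -- This slope bound degenerates as `ε → 0`; it serves only to dominate the difference quotients
  -- for fixed `ε`.
  have hp : ∀ x ∈ Icc a c, |(f x (v x) - F x) / ε| ≤ (L + C) / ε := fun x hx => by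
    rw [abs_div, abs_of_pos hε]
    gcongr
    refine (abs_sub _ _).trans (add_le_add ((hf.abs_le_mul hL _ _).trans ?_) (hC x hx))
    rw [abs_of_nonneg (hv x).1]
    exact mul_le_of_le_one_right hL0 (hv x).2
  have htn : Tendsto (fun n : ℕ => (c - b) / ((n : ℝ) + 1)) atTop (𝓝 0) :=
    tendsto_const_nhds.div_atTop (tendsto_atTop_add_const_right _ _ tendsto_natCast_atTop_atTop)
  have htpos : ∀ n : ℕ, 0 < (c - b) / ((n : ℝ) + 1) := fun n => by
    have : 0 < c - b := by linarith
    positivity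
  have htle : ∀ n : ℕ, (c - b) / ((n : ℝ) + 1) ≤ c - b := fun n =>
    div_le_self (by linarith) (by linarith [n.cast_nonneg (α := ℝ)])
  generalize hs : (fun n : ℕ => (c - b) / ((n : ℝ) + 1)) = s at htn
  have hspos : ∀ n, 0 < s n := fun n => by rw [← hs]; exact htpos n
  have hsle : ∀ n, s n ≤ c - b := fun n => by rw [← hs]; exact htle n
  have hlim : Tendsto (fun n => ∫ x in a..b, |(v (x + s n) - v x) / s n|) atTop
      (𝓝 (∫ x in a..b, |(f x (v x) - F x) / ε|)) := by
    refine intervalIntegral.tendsto_integral_filter_of_dominated_convergence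
      (fun _ => (L + C) / ε) (Eventually.of_forall fun n => ?_) (Eventually.of_forall fun n => ?_)
      intervalIntegrable_const ?_
    · have hvc := h.profile.continuous
      exact (by fun_prop : Continuous fun x => |(v (x + s n) - v x) / s n|).aestronglyMeasurable
    · refine Eventually.of_forall fun x hx => ?_
      rw [uIoc_of_le hab] at hx
      have h1 : |v (x + s n) - v x| ≤ (L + C) / ε * |x + s n - x| := by
        rw [h.profile.sub_eq, ← Real.norm_eq_abs]
        refine intervalIntegral.norm_integral_le_of_norm_le_const fun y hy => ?_
        rw [uIoc_of_le (by linarith [hspos n])] at hy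
        exact hp y ⟨by linarith [hx.1, hy.1], by linarith [hx.2, hy.2, hsle n]⟩
      rw [add_sub_cancel_left, ← div_le_iff₀ (abs_pos.2 (hspos n).ne')] at h1
      rwa [Real.norm_eq_abs, abs_abs, abs_div]
    · filter_upwards [h.profile.ae_hasDerivAt] with x hx _
      have h1 : Tendsto s atTop (𝓝[≠] 0) :=
        tendsto_nhdsWithin_iff.2 ⟨htn, Eventually.of_forall fun n => (hspos n).ne'⟩
      have h2 := Tendsto.comp (hasDerivAt_iff_tendsto_slope_zero.1 hx) h1
      refine h2.abs.congr fun n => ?_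
      simp only [Function.comp, smul_eq_mul]
      rw [div_eq_inv_mul]
  refine le_of_tendsto hlim (Eventually.of_forall fun n => ?_)
  have h1 := hstep (s n) (hspos n).le (hsle n)
  simp only [abs_div, abs_of_pos (hspos n)]
  rwa [intervalIntegral.integral_div, div_le_iff₀ (hspos n)]

/-- The profile is a difference of two increasing functions bounded independently of `ε`. -/
theorem exists_monotone_add_monotone (hf : FluxF1 f fl fr) (hlam : 0 < lam) (hε : 0 < ε)
    (hwi : Integrable w volume) (hw : ∀ᵐ x, 0 ≤ w x ∧ w x ≤ 1)
    (hv : ∀ x, 0 ≤ v x ∧ v x ≤ 1) {M : ℝ} (hM : ∀ a b h : ℝ, a ≤ b → 0 ≤ h →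
      ∫ x in a..b, |w (x + h) - w x| ≤ M * h)
    (h : ResolventPair f lam ε w v F) :
    ∃ G : ℝ → ℝ, Monotone G ∧ (∀ x, |G x| ≤ M + 2) ∧ Monotone fun x => v x + G x := by
  have hpi : ∀ a b, IntervalIntegrable (fun x => |(f x (v x) - F x) / ε|) volume a b :=
    fun a b => (h.profile.intervalIntegrable a b).abs
  have hG := IsPrimitive.integral hpi 0
  set G := fun x => ∫ t in (0 : ℝ)..x, |(f t (v t) - F t) / ε| with hGdef
  have hG0 : G 0 = 0 := intervalIntegral.integral_same
  have hincr : ∀ x y, x ≤ y → |v y - v x| ≤ G y - G x := fun x y hxy => by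
    rw [h.profile.sub_eq, hG.sub_eq]
    exact intervalIntegral.abs_integral_le_integral_abs hxy
  have hmono : Monotone G := fun x y hxy =>
    sub_nonneg.1 ((abs_nonneg _).trans (hincr x y hxy))
  -- The shift needs room before the interface, so the bound is first obtained for `b < 0` and
  -- extended to `b = 0` by continuity of `G`. Measuring the variation from the origin bounds each
  -- half line separately by `M + 2`.
  have hleft : ∀ a < 0, ∀ b ∈ Ico a 0, G b - G a ≤ M + 2 := fun a ha b hb => by
    rw [hG.sub_eq]
    refine h.integral_abs_deriv_le_of_side hf hlam hε hwi hw hv hM hb.1 hb.2 fun x hx => ?_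
    ext y
    rw [hf.eq_left x y hx.2, hf.eq_left a y ha.le]
  have hright : ∀ b > 0, ∀ a ∈ Ioc 0 b, G b - G a ≤ M + 2 := fun b hb a ha => by
    rw [hG.sub_eq]
    refine h.integral_abs_deriv_le_of_side hf hlam hε hwi hw hv hM ha.2 (lt_add_one b)
      fun x hx => ?_
    ext y
    rw [hf.eq_right x y (ha.1.trans_le hx.1), hf.eq_right a y ha.1]
  refine ⟨G, hmono, fun x => ?_, fun x y hxy => ?_⟩
  · rcases lt_trichotomy x 0 with hx | rfl | hx
    · have hlim : Tendsto (fun b => G b - G x) (𝓝[<] 0) (𝓝 (G 0 - G x)) :=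
        (hG.continuous.tendsto 0).sub_const _ |>.mono_left nhdsWithin_le_nhds
      have h1 : G 0 - G x ≤ M + 2 := le_of_tendsto hlim (by
        filter_upwards [Ico_mem_nhdsLT hx] with b hb using hleft x hx b hb)
      have h2 := hmono hx.le
      rw [abs_of_nonpos (by linarith)]
      linarith
    · have h1 := (abs_nonneg _).trans (hincr 1 2 one_le_two)
      have h2 := hright 2 two_pos 1 ⟨one_pos, one_le_two⟩
      rw [hG0, abs_zero]
      linarith
    · have hlim : Tendsto (fun a => G x - G a) (𝓝[>] 0) (𝓝 (G x - G 0)) :=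
        (hG.continuous.tendsto 0).const_sub _ |>.mono_left nhdsWithin_le_nhds
      have h1 : G x - G 0 ≤ M + 2 := le_of_tendsto hlim (by
        filter_upwards [Ioc_mem_nhdsGT hx] with a ha using hright x hx a ha)
      have h2 := hmono hx.le
      rw [abs_of_nonneg (by linarith)]
      linarith
  · have := (abs_le.1 (hincr x y hxy)).1
    simp only
    linarith

end ResolventPair

/-! ### The vanishing viscosity limit and its flux -/

/-- A sequence of viscous profiles with values in `[0, 1]` converging pointwise to `u` as the
viscosity tends to `0`. -/
structure VanishingViscosity (f : ℝ → ℝ → ℝ) (lam : ℝ) (w : ℝ → ℝ) (ε : ℕ → ℝ)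
    (v F : ℕ → ℝ → ℝ) (u : ℝ → ℝ) : Prop where
  pos : ∀ n, 0 < ε n
  tendsto_zero : Tendsto ε atTop (𝓝 0)
  pair : ∀ n, ResolventPair f lam (ε n) w (v n) (F n)
  mem_Icc : ∀ n x, 0 ≤ v n x ∧ v n x ≤ 1
  tendsto : ∀ x, Tendsto (fun n => v n x) atTop (𝓝 (u x))

theorem FluxF1.continuous {f : ℝ → ℝ → ℝ} {fl fr : ℝ → ℝ} (hf : FluxF1 f fl fr) (x : ℝ) :
    Continuous (f x) :=
  (hf.f0.smooth x).continuous

namespace VanishingViscosity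

variable {f : ℝ → ℝ → ℝ} {fl fr : ℝ → ℝ} {lam : ℝ} {w : ℝ → ℝ} {ε : ℕ → ℝ} {v F : ℕ → ℝ → ℝ}
  {u : ℝ → ℝ}

theorem limit_mem_Icc (h : VanishingViscosity f lam w ε v F u) (x : ℝ) : 0 ≤ u x ∧ u x ≤ 1 :=
  ⟨ge_of_tendsto' (h.tendsto x) fun n => (h.mem_Icc n x).1,
    le_of_tendsto' (h.tendsto x) fun n => (h.mem_Icc n x).2⟩

theorem measurable_limit (h : VanishingViscosity f lam w ε v F u) : Measurable u :=
  measurable_of_tendsto_metrizable (fun n => (h.pair n).profile.continuous.measurable)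
    (tendsto_pi_nhds.2 h.tendsto)

theorem tendsto_integral (h : VanishingViscosity f lam w ε v F u) (a b : ℝ) :
    Tendsto (fun n => ∫ x in a..b, v n x) atTop (𝓝 (∫ x in a..b, u x)) := by
  refine intervalIntegral.tendsto_integral_filter_of_dominated_convergence (fun _ => 1)
    (Eventually.of_forall fun n => (h.pair n).profile.continuous.aestronglyMeasurable)
    (Eventually.of_forall fun n => Eventually.of_forall fun x _ => ?_) intervalIntegrable_const
    (Eventually.of_forall fun x _ => h.tendsto x)
  rw [Real.norm_of_nonneg (h.mem_Icc n x).1]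
  exact (h.mem_Icc n x).2

theorem intervalIntegrable_limit (h : VanishingViscosity f lam w ε v F u) (a b : ℝ) :
    IntervalIntegrable u volume a b := by
  refine (intervalIntegrable_const (c := (1 : ℝ))).mono_fun
    h.measurable_limit.aestronglyMeasurable (Eventually.of_forall fun x => ?_)
  simp only [Real.norm_of_nonneg (h.limit_mem_Icc x).1, norm_one]
  exact (h.limit_mem_Icc x).2

/-- Each profile is nonnegative with mass `∫ w`, and this bound on bounded intervals survives the
limit. -/
theorem integrable_limit (hf : FluxF1 f fl fr) (hlam : 0 < lam) (hw : Integrable w volume)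
    (h : VanishingViscosity f lam w ε v F u) : Integrable u volume := by
  refine integrable_of_intervalIntegral_norm_bounded (l := atTop) (∫ x, w x)
    (fun i : ℝ => (h.intervalIntegrable_limit (-i) i).1) tendsto_neg_atTop_atBot tendsto_id ?_
  filter_upwards [eventually_ge_atTop 0] with r hr
  simp only [Real.norm_of_nonneg (h.limit_mem_Icc _).1]
  refine le_of_tendsto' (h.tendsto_integral (-r) r) fun n => ?_
  rw [← (h.pair n).integral_eq hf hlam (h.pos n) hw,
    intervalIntegral.integral_of_le (by linarith)]
  exact setIntegral_le_integral (h.pair n).integrable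
    (Eventually.of_forall fun x => (h.mem_Icc n x).1)

theorem tendsto_integral_flux (hf : FluxF1 f fl fr) (h : VanishingViscosity f lam w ε v F u)
    (a b : ℝ) :
    Tendsto (fun n => ∫ x in a..b, f x (v n x)) atTop (𝓝 (∫ x in a..b, f x (u x))) := by
  obtain ⟨L, hL0, hL⟩ := hf.f0.lipschitz
  refine intervalIntegral.tendsto_integral_filter_of_dominated_convergence (fun _ => L)
    (Eventually.of_forall fun n =>
      (hf.integrable_comp (h.pair n).integrable).aestronglyMeasurable.restrict)
    (Eventually.of_forall fun n => Eventually.of_forall fun x _ => ?_) intervalIntegrable_const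
    (Eventually.of_forall fun x _ => ((hf.continuous x).tendsto _).comp (h.tendsto x))
  refine (hf.abs_le_mul hL x _).trans ?_
  rw [abs_of_nonneg (h.mem_Icc n x).1]
  exact mul_le_of_le_one_right hL0 (h.mem_Icc n x).2

/-- The total fluxes converge to a Lipschitz function, which equals `f (x, u)` almost
everywhere. -/
theorem exists_limit_flux (hf : FluxF1 f fl fr) (hlam : 0 < lam) (hwi : Integrable w volume)
    (hw : ∀ᵐ x, 0 ≤ w x ∧ w x ≤ 1) (h : VanishingViscosity f lam w ε v F u) :
    ∃ F₀ : ℝ → ℝ, (∀ x, Tendsto (fun n => F n x) atTop (𝓝 (F₀ x))) ∧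
      IsPrimitive F₀ (fun x => (w x - u x) / lam) ∧ ∀ᵐ x, F₀ x = f x (u x) := by
  have hA : IsPrimitive (fun x => ∫ t in (0 : ℝ)..x, (w t - u t) / lam)
      fun x => (w x - u x) / lam := IsPrimitive.integral (fun a b =>
    (hwi.intervalIntegrable.sub (h.intervalIntegrable_limit a b)).div_const lam) 0
  set A := fun x => ∫ t in (0 : ℝ)..x, (w t - u t) / lam with hAdef
  have hAn : ∀ x, Tendsto (fun n => F n x - F n 0) atTop (𝓝 (A x)) := fun x => by
    have h1 : ∀ n, F n x - F n 0 = ((∫ t in (0 : ℝ)..x, w t) - ∫ t in (0 : ℝ)..x, v n t) / lam :=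
      fun n => by
        rw [(h.pair n).flux.sub_eq, intervalIntegral.integral_div, intervalIntegral.integral_sub
          hwi.intervalIntegrable ((h.pair n).profile.continuous.intervalIntegrable _ _)]
    have h2 : A x = ((∫ t in (0 : ℝ)..x, w t) - ∫ t in (0 : ℝ)..x, u t) / lam := by
      rw [hAdef]
      simp only
      rw [intervalIntegral.integral_div, intervalIntegral.integral_sub
          hwi.intervalIntegrable (h.intervalIntegrable_limit _ _)]
    simp only [h1, h2]
    exact ((h.tendsto_integral 0 x).const_sub _).div_const _
  have hintA : ∀ a b, Tendsto (fun n => ∫ x in a..b, (F n x - F n 0)) atTop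
      (𝓝 (∫ x in a..b, A x)) := fun a b => by
    refine intervalIntegral.tendsto_integral_filter_of_dominated_convergence
      (fun x => |x - 0| / lam) (Eventually.of_forall fun n =>
        ((h.pair n).flux.continuous.sub continuous_const).aestronglyMeasurable)
      (Eventually.of_forall fun n => Eventually.of_forall fun x _ =>
        (h.pair n).abs_flux_sub_le hlam hw (h.mem_Icc n) 0 x)
      ((by fun_prop : Continuous fun x : ℝ => |x - 0| / lam).intervalIntegrable _ _)
      (Eventually.of_forall fun x _ => hAn x)
  -- Integrating the profile equation bounds the viscous part by `ε` times a bounded increment of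
  -- `v`, so it drops out of the averages of the flux.
  have hintF : ∀ a b, Tendsto (fun n => ∫ x in a..b, F n x) atTop
      (𝓝 (∫ x in a..b, f x (u x))) := fun a b => by
    have h1 : ∀ n, (∫ x in a..b, f x (v n x)) - ε n * (v n b - v n a) = ∫ x in a..b, F n x :=
      fun n => by
        rw [(h.pair n).profile.sub_eq, intervalIntegral.integral_div, intervalIntegral.integral_sub
          (hf.integrable_comp (h.pair n).integrable).intervalIntegrable
          ((h.pair n).flux.continuous.intervalIntegrable _ _), mul_div_cancel₀ _ (h.pos n).ne']
        ring
    have h2 := (h.tendsto_integral_flux hf a b).sub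
      (h.tendsto_zero.mul ((h.tendsto b).sub (h.tendsto a)))
    rw [zero_mul, sub_zero] at h2
    exact h2.congr h1
  have hsplit : ∀ a b n, ∫ x in a..b, F n x = (∫ x in a..b, (F n x - F n 0)) + (b - a) * F n 0 :=
    fun a b n => by
      rw [intervalIntegral.integral_sub ((h.pair n).flux.continuous.intervalIntegrable _ _)
        intervalIntegrable_const, intervalIntegral.integral_const, smul_eq_mul]
      ring
  -- The increments of `F n` already converge; its value at the origin is recovered from the average
  -- over the unit interval.
  set c := (∫ x in (0 : ℝ)..1, f x (u x)) - ∫ x in (0 : ℝ)..1, A x with hc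
  have hc0 : Tendsto (fun n => F n 0) atTop (𝓝 c) := by
    refine ((hintF 0 1).sub (hintA 0 1)).congr fun n => ?_
    rw [hsplit]
    ring
  have hF₀ : IsPrimitive (fun x => A x + c) fun x => (w x - u x) / lam := by
    simpa using hA.add (IsPrimitive.const c)
  refine ⟨fun x => A x + c, fun x => ?_, hF₀, ?_⟩
  · simpa using (hAn x).add hc0
  · have hui : ∀ a b, IntervalIntegrable (fun x => f x (u x)) volume a b := fun a b =>
      (hf.integrable_comp (h.integrable_limit hf hlam hwi)).intervalIntegrable
    -- The difference of the limit flux and `f(x, u)` integrates to zero over every interval, hence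
    -- vanishes almost everywhere.
    have hz : IsPrimitive (fun _ => 0) fun x => (A x + c) - f x (u x) := by
      refine ⟨fun a b => (hF₀.continuous.intervalIntegrable a b).sub (hui a b), fun a b => ?_⟩
      rw [intervalIntegral.integral_sub (hF₀.continuous.intervalIntegrable a b) (hui a b),
        sub_zero, eq_comm, sub_eq_zero]
      refine tendsto_nhds_unique ?_ (hintF a b)
      simp only [hsplit]
      rw [intervalIntegral.integral_add (hA.continuous.intervalIntegrable a b)
        intervalIntegrable_const, intervalIntegral.integral_const, smul_eq_mul]
      exact (hintA a b).add (hc0.const_mul _)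
    filter_upwards [hz.ae_hasDerivAt] with x hx
    have := hx.unique (hasDerivAt_const x 0)
    linarith

end VanishingViscosity

theorem solvesLimitEquation_of_isPrimitive {f : ℝ → ℝ → ℝ} {lam : ℝ} {w u F₀ : ℝ → ℝ}
    (hlam : 0 < lam) (hw : Integrable w volume) (hu : Integrable u volume)
    (hF₀ : IsPrimitive F₀ fun x => (w x - u x) / lam) (hae : ∀ᵐ x, F₀ x = f x (u x)) :
    SolvesLimitEquation f lam w u := by
  intro φ hφ hφc
  have hφd : Continuous (deriv φ) := hφ.continuous_deriv (by simp)
  have h1 := hF₀.integral_mul_test (hφ.of_le (by simp)) hφc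
  have h2 : ∫ x, (u x * φ x - lam * f x (u x) * deriv φ x) =
      ∫ x, (u x * φ x - lam * (F₀ x * deriv φ x)) :=
    integral_congr_ae (by
      filter_upwards [hae] with x hx
      rw [hx, mul_assoc])
  have iw := hw.locallyIntegrable.integrable_mul_test hφ.continuous hφc
  have iu := hu.locallyIntegrable.integrable_mul_test hφ.continuous hφc
  have iF := (hF₀.continuous.locallyIntegrable (μ := volume)).integrable_mul_test hφd hφc.deriv
  have h3 : ∫ x, (w x - u x) / lam * φ x = ((∫ x, w x * φ x) - ∫ x, u x * φ x) / lam := by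
    rw [← integral_sub iw iu, ← integral_div]
    congr 1
    ext x
    ring
  rw [h3, div_eq_iff hlam.ne'] at h1
  rw [h2, integral_sub iu (iF.const_mul _), integral_const_mul]
  linarith

/-! ### Level crossings and jump conditions -/

/-- At some point where the profile crosses the level `k` upwards, the total flux lies below the
flux of `k`. -/
theorem exists_flux_le_of_crossing {g v F : ℝ → ℝ} {ε c d k : ℝ} (hε : 0 < ε) (hcd : c ≤ d)
    (hg : Continuous g) (hv : Continuous v) (hF : Continuous F)
    (h : ∀ x ∈ Icc c d, v x - v c = ∫ t in c..x, (g (v t) - F t) / ε)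
    (hc : v c < k) (hd : k < v d) : ∃ z ∈ Icc c d, F z ≤ g k := by
  -- If `F > g k` throughout, then `v' < 0` whenever `v = k`, so the constant `k` is a barrier that
  -- `v` cannot cross upwards.
  by_contra! hcon
  have hcont : Continuous fun t => (g (v t) - F t) / ε := by fun_prop
  have hder : ∀ x, HasDerivAt (fun x => v c + ∫ t in c..x, (g (v t) - F t) / ε)
      ((g (v x) - F x) / ε) x := fun x =>
    (intervalIntegral.integral_hasDerivAt_right (hcont.intervalIntegrable _ _)
      (hcont.stronglyMeasurableAtFilter _ _) hcont.continuousAt).const_add _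
  have heq : ∀ x ∈ Icc c d, v c + ∫ t in c..x, (g (v t) - F t) / ε = v x := fun x hx => by
    rw [← h x hx]
    ring
  have key := image_le_of_deriv_right_lt_deriv_boundary (a := c) (b := d)
    (f := fun x => v c + ∫ t in c..x, (g (v t) - F t) / ε) (B := fun _ => k) (B' := fun _ => 0)
    (fun x _ => (hder x).continuousAt.continuousWithinAt)
    (fun x _ => (hder x).hasDerivWithinAt)
    (by simpa using hc.le) (fun x => hasDerivAt_const x k) (fun x hx hxk => by
      have hx' : x ∈ Icc c d := Ico_subset_Icc_self hx
      rw [heq x hx'] at hxk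
      rw [hxk]
      exact div_neg_of_neg_of_pos (sub_neg.2 (hcon x hx')) hε) (right_mem_Icc.2 hcd)
  rw [heq d (right_mem_Icc.2 hcd)] at key
  linarith

/-- The upward case after changing the signs of `v` and `F` and replacing `g` by `-g(-·)`. -/
theorem exists_le_flux_of_crossing {g v F : ℝ → ℝ} {ε c d k : ℝ} (hε : 0 < ε) (hcd : c ≤ d)
    (hg : Continuous g) (hv : Continuous v) (hF : Continuous F)
    (h : ∀ x ∈ Icc c d, v x - v c = ∫ t in c..x, (g (v t) - F t) / ε)
    (hc : k < v c) (hd : v d < k) : ∃ z ∈ Icc c d, g k ≤ F z := by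
  obtain ⟨z, hz, hz'⟩ := exists_flux_le_of_crossing (g := fun s => -g (-s)) (v := fun x => -v x)
    (F := fun x => -F x) (k := -k) hε hcd (by fun_prop) hv.neg hF.neg (fun x hx => by
      have e : (fun t => (-g (-(-v t)) - -F t) / ε) = fun t => -((g (v t) - F t) / ε) := by
        ext t
        rw [neg_neg]
        ring
      rw [e, intervalIntegral.integral_neg, ← h x hx]
      ring) (by simpa using hc) (by simpa using hd)
  exact ⟨z, hz, by simpa using hz'⟩

namespace VanishingViscosity

variable {f : ℝ → ℝ → ℝ} {fl fr g : ℝ → ℝ} {lam : ℝ} {w : ℝ → ℝ} {ε : ℕ → ℝ} {v F : ℕ → ℝ → ℝ}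
  {u F₀ : ℝ → ℝ} {c d k : ℝ}

/-- The left endpoint is excluded from the condition on the flux so that intervals starting at the
interface, where `f` still takes its left value, are covered. -/
theorem profile_sub_eq (h : VanishingViscosity f lam w ε v F u)
    (hside : ∀ x ∈ Ioc c d, f x = g) (n : ℕ) (x : ℝ) (hx : x ∈ Icc c d) :
    v n x - v n c = ∫ t in c..x, (g (v n t) - F n t) / ε n := by
  rw [(h.pair n).profile.sub_eq]
  refine intervalIntegral.integral_congr_ae (Eventually.of_forall fun t ht => ?_)
  rw [uIoc_of_le hx.1] at ht
  rw [hside t ⟨ht.1, ht.2.trans hx.2⟩]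

/-- For large `n` the profile itself crosses `k` in the interval. The crossing point depends on `n`,
but the uniform Lipschitz bound moves the flux to `c` at a cost of `(d - c) / λ`. -/
theorem limit_flux_le (hlam : 0 < lam) (hw : ∀ᵐ x, 0 ≤ w x ∧ w x ≤ 1)
    (h : VanishingViscosity f lam w ε v F u)
    (hF₀ : ∀ x, Tendsto (fun n => F n x) atTop (𝓝 (F₀ x))) (hg : Continuous g)
    (hside : ∀ x ∈ Ioc c d, f x = g) (hcd : c ≤ d) (hc : u c < k) (hd : k < u d) :
    F₀ c - (d - c) / lam ≤ g k := by
  refine le_of_tendsto ((hF₀ c).sub_const _) ?_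
  filter_upwards [(h.tendsto c).eventually (gt_mem_nhds hc),
    (h.tendsto d).eventually (lt_mem_nhds hd)] with n hn1 hn2
  obtain ⟨z, hz, hzk⟩ := exists_flux_le_of_crossing (h.pos n) hcd hg
    (h.pair n).profile.continuous (h.pair n).flux.continuous (h.profile_sub_eq hside n) hn1 hn2
  have h1 := (h.pair n).abs_flux_sub_le hlam hw (h.mem_Icc n) c z
  rw [abs_of_nonneg (sub_nonneg.2 hz.1)] at h1
  have h2 : (z - c) / lam ≤ (d - c) / lam := by
    gcongr
    exact hz.2
  linarith [(abs_le.1 h1).1]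

theorem le_limit_flux (hlam : 0 < lam) (hw : ∀ᵐ x, 0 ≤ w x ∧ w x ≤ 1)
    (h : VanishingViscosity f lam w ε v F u)
    (hF₀ : ∀ x, Tendsto (fun n => F n x) atTop (𝓝 (F₀ x))) (hg : Continuous g)
    (hside : ∀ x ∈ Ioc c d, f x = g) (hcd : c ≤ d) (hc : k < u c) (hd : u d < k) :
    g k ≤ F₀ c + (d - c) / lam := by
  refine ge_of_tendsto ((hF₀ c).add_const _) ?_
  filter_upwards [(h.tendsto c).eventually (lt_mem_nhds hc),
    (h.tendsto d).eventually (gt_mem_nhds hd)] with n hn1 hn2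
  obtain ⟨z, hz, hzk⟩ := exists_le_flux_of_crossing (h.pos n) hcd hg
    (h.pair n).profile.continuous (h.pair n).flux.continuous (h.profile_sub_eq hside n) hn1 hn2
  have h1 := (h.pair n).abs_flux_sub_le hlam hw (h.mem_Icc n) c z
  rw [abs_of_nonneg (sub_nonneg.2 hz.1)] at h1
  have h2 : (z - c) / lam ≤ (d - c) / lam := by
    gcongr
    exact hz.2
  linarith [(abs_le.1 h1).2]

end VanishingViscosity

theorem boundedVariationOn_of_abs_sub_le {u G : ℝ → ℝ} {C : ℝ} (hG : Monotone G)
    (hb : ∀ x, |G x| ≤ C) (h : ∀ x y, x ≤ y → |u y - u x| ≤ G y - G x) :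
    BoundedVariationOn u univ := by
  have h1 : BoundedVariationOn G univ :=
    (hG.monotoneOn univ).boundedVariationOn fun x _ => hb x
  refine ne_top_of_le_ne_top h1 (iSup_mono fun p => Finset.sum_le_sum fun i _ => ?_)
  rw [edist_dist, edist_dist, Real.dist_eq, Real.dist_eq]
  exact ENNReal.ofReal_le_ofReal ((h _ _ (p.2.2.1 i.le_succ)).trans (le_abs_self _))

/-- Crossing arguments reach only levels strictly inside the jump; continuity gives the endpoints,
except for a degenerate interval, which is assumed separately. -/
theorem forall_mem_Icc_le_of_forall_mem_Ioo {g : ℝ → ℝ} {m a b : ℝ} (hg : Continuous g)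
    (hab : a = b → m ≤ g a) (h : ∀ k ∈ Ioo a b, m ≤ g k) : ∀ k ∈ Icc a b, m ≤ g k := by
  intro k hk
  rcases eq_or_ne a b with hne | hne
  · have : k = a := le_antisymm (by rw [hne]; exact hk.2) hk.1
    rw [this]
    exact hab hne
  · rw [← closure_Ioo hne] at hk
    exact (closure_minimal (s := Ioo a b) (t := {k | m ≤ g k}) h
      (isClosed_le continuous_const hg)) hk

theorem forall_mem_Icc_ge_of_forall_mem_Ioo {g : ℝ → ℝ} {m a b : ℝ} (hg : Continuous g)
    (hab : a = b → g a ≤ m) (h : ∀ k ∈ Ioo a b, g k ≤ m) : ∀ k ∈ Icc a b, g k ≤ m := by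
  intro k hk
  have := forall_mem_Icc_le_of_forall_mem_Ioo hg.neg (m := -m)
    (fun e => neg_le_neg (hab e)) (fun k hk => neg_le_neg (h k hk)) k hk
  exact neg_le_neg_iff.1 this

/-- A set of full measure is dense, so it meets every left neighbourhood of `x₀`. This gives the
Rankine-Hugoniot condition: both one-sided fluxes equal the value of the continuous `F₀`. -/
theorem eq_of_tendsto_of_ae_eq_left {F₀ q : ℝ → ℝ} {x₀ l : ℝ} (hF : Continuous F₀)
    (hq : Tendsto q (𝓝[<] x₀) (𝓝 l)) (hae : ∀ᵐ x, F₀ x = q x) : F₀ x₀ = l := by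
  refine tendsto_nhds_unique_of_frequently_eq ((hF.tendsto x₀).mono_left nhdsWithin_le_nhds) hq ?_
  rw [frequently_iff]
  intro U hU
  obtain ⟨l, hl, hsub⟩ := mem_nhdsLT_iff_exists_Ioo_subset.1 hU
  obtain ⟨z, hz, hz'⟩ := (Measure.dense_of_ae hae).exists_between hl
  exact ⟨z, hsub hz', hz⟩

theorem eq_of_tendsto_of_ae_eq_right {F₀ q : ℝ → ℝ} {x₀ l : ℝ} (hF : Continuous F₀)
    (hq : Tendsto q (𝓝[>] x₀) (𝓝 l)) (hae : ∀ᵐ x, F₀ x = q x) : F₀ x₀ = l := by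
  refine tendsto_nhds_unique_of_frequently_eq ((hF.tendsto x₀).mono_left nhdsWithin_le_nhds) hq ?_
  rw [frequently_iff]
  intro U hU
  obtain ⟨l, hl, hsub⟩ := mem_nhdsGT_iff_exists_Ioo_subset.1 hU
  obtain ⟨z, hz, hz'⟩ := (Measure.dense_of_ae hae).exists_between hl
  exact ⟨z, hsub hz', hz⟩

namespace VanishingViscosity

variable {f : ℝ → ℝ → ℝ} {fl fr g : ℝ → ℝ} {lam : ℝ} {w : ℝ → ℝ} {ε : ℕ → ℝ} {v F : ℕ → ℝ → ℝ}
  {u F₀ : ℝ → ℝ} {c d : ℝ → ℝ} {x₀ k um up : ℝ}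

theorem limit_flux_le_of_tendsto (hlam : 0 < lam) (hw : ∀ᵐ x, 0 ≤ w x ∧ w x ≤ 1)
    (h : VanishingViscosity f lam w ε v F u)
    (hF₀ : ∀ x, Tendsto (fun n => F n x) atTop (𝓝 (F₀ x))) (hF₀c : Continuous F₀)
    (hg : Continuous g) (hc : Tendsto c (𝓝[>] 0) (𝓝 x₀)) (hd : Tendsto d (𝓝[>] 0) (𝓝 x₀))
    (hcd : ∀ᶠ δ in 𝓝[>] (0 : ℝ), c δ ≤ d δ ∧ ∀ x ∈ Ioc (c δ) (d δ), f x = g)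
    (huc : ∀ᶠ δ in 𝓝[>] (0 : ℝ), u (c δ) < k) (hud : ∀ᶠ δ in 𝓝[>] (0 : ℝ), k < u (d δ)) :
    F₀ x₀ ≤ g k := by
  have hlim : Tendsto (fun δ => F₀ (c δ) - (d δ - c δ) / lam) (𝓝[>] 0)
      (𝓝 (F₀ x₀ - (x₀ - x₀) / lam)) :=
    ((hF₀c.tendsto x₀).comp hc).sub ((hd.sub hc).div_const lam)
  rw [sub_self, zero_div, sub_zero] at hlim
  refine le_of_tendsto hlim ?_
  filter_upwards [hcd, huc, hud] with δ h1 h2 h3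
  exact h.limit_flux_le hlam hw hF₀ hg h1.2 h1.1 h2 h3

theorem le_limit_flux_of_tendsto (hlam : 0 < lam) (hw : ∀ᵐ x, 0 ≤ w x ∧ w x ≤ 1)
    (h : VanishingViscosity f lam w ε v F u)
    (hF₀ : ∀ x, Tendsto (fun n => F n x) atTop (𝓝 (F₀ x))) (hF₀c : Continuous F₀)
    (hg : Continuous g) (hc : Tendsto c (𝓝[>] 0) (𝓝 x₀)) (hd : Tendsto d (𝓝[>] 0) (𝓝 x₀))
    (hcd : ∀ᶠ δ in 𝓝[>] (0 : ℝ), c δ ≤ d δ ∧ ∀ x ∈ Ioc (c δ) (d δ), f x = g)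
    (huc : ∀ᶠ δ in 𝓝[>] (0 : ℝ), k < u (c δ)) (hud : ∀ᶠ δ in 𝓝[>] (0 : ℝ), u (d δ) < k) :
    g k ≤ F₀ x₀ := by
  have hlim : Tendsto (fun δ => F₀ (c δ) + (d δ - c δ) / lam) (𝓝[>] 0)
      (𝓝 (F₀ x₀ + (x₀ - x₀) / lam)) :=
    ((hF₀c.tendsto x₀).comp hc).add ((hd.sub hc).div_const lam)
  rw [sub_self, zero_div, add_zero] at hlim
  refine ge_of_tendsto hlim ?_
  filter_upwards [hcd, huc, hud] with δ h1 h2 h3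
  exact h.le_limit_flux hlam hw hF₀ hg h1.2 h1.1 h2 h3

theorem jump_conditions (hf : FluxF1 f fl fr) (hlam : 0 < lam) (hw : ∀ᵐ x, 0 ≤ w x ∧ w x ≤ 1)
    (h : VanishingViscosity f lam w ε v F u)
    (hF₀ : ∀ x, Tendsto (fun n => F n x) atTop (𝓝 (F₀ x))) (hF₀c : Continuous F₀)
    (hae : ∀ᵐ x, F₀ x = f x (u x))
    (hum : Tendsto u (𝓝[<] x₀) (𝓝 um)) (hup : Tendsto u (𝓝[>] x₀) (𝓝 up)) :
    Tendsto (fun x => f x um) (𝓝[<] x₀) (𝓝 (F₀ x₀)) ∧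
    Tendsto (fun x => f x up) (𝓝[>] x₀) (𝓝 (F₀ x₀)) ∧
    (um < up → x₀ ≠ 0 → ∀ k ∈ Icc um up, F₀ x₀ ≤ f x₀ k) ∧
    (up < um → x₀ ≠ 0 → ∀ k ∈ Icc up um, f x₀ k ≤ F₀ x₀) ∧
    (um < up → x₀ = 0 → ∃ us ∈ Icc um up,
      (∀ k ∈ Icc um us, F₀ x₀ ≤ fl k) ∧ (∀ k ∈ Icc us up, F₀ x₀ ≤ fr k)) ∧
    (up < um → x₀ = 0 → ∃ us ∈ Icc up um,
      (∀ k ∈ Icc up us, fr k ≤ F₀ x₀) ∧ (∀ k ∈ Icc us um, fl k ≤ F₀ x₀)) := by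
  have hflc := hf.smooth_left.continuous
  have hfrc := hf.smooth_right.continuous
  have hfl : ∀ x, x ≤ 0 → f x = fl := fun x hx => funext fun y => hf.eq_left x y hx
  have hfr : ∀ x, 0 < x → f x = fr := fun x hx => funext fun y => hf.eq_right x y hx
  -- `gl` and `gr` are the fluxes in force just to the left and right of `x₀`; they differ only at
  -- the origin.
  obtain ⟨gl, hglc, hgl, hgl0⟩ : ∃ gl : ℝ → ℝ, Continuous gl ∧ (∀ᶠ x in 𝓝[<] x₀, f x = gl) ∧
      (x₀ = 0 → gl = fl) := by
    rcases le_or_gt x₀ 0 with hx | hx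
    · refine ⟨fl, hflc, ?_, fun _ => rfl⟩
      filter_upwards [self_mem_nhdsWithin] with x hx'
      exact hfl x ((le_of_lt hx').trans hx)
    · refine ⟨fr, hfrc, ?_, fun e => absurd e hx.ne'⟩
      filter_upwards [Ioo_mem_nhdsLT hx] with x hx'
      exact hfr x hx'.1
  obtain ⟨gr, hgrc, hgr, hgr0⟩ : ∃ gr : ℝ → ℝ, Continuous gr ∧ (∀ᶠ x in 𝓝[>] x₀, f x = gr) ∧
      (x₀ = 0 → gr = fr) := by
    rcases lt_or_ge x₀ 0 with hx | hx
    · refine ⟨fl, hflc, ?_, fun e => absurd e hx.ne⟩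
      filter_upwards [Ioo_mem_nhdsGT hx] with x hx'
      exact hfl x hx'.2.le
    · refine ⟨fr, hfrc, ?_, fun _ => rfl⟩
      filter_upwards [self_mem_nhdsWithin] with x hx'
      exact hfr x (lt_of_le_of_lt hx hx')
  have hFm : F₀ x₀ = gl um := by
    refine eq_of_tendsto_of_ae_eq_left hF₀c (((hglc.tendsto um).comp hum).congr' ?_) hae
    filter_upwards [hgl] with x hx
    rw [hx, Function.comp]
  have hFp : F₀ x₀ = gr up := by
    refine eq_of_tendsto_of_ae_eq_right hF₀c (((hgrc.tendsto up).comp hup).congr' ?_) hae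
    filter_upwards [hgr] with x hx
    rw [hx, Function.comp]
  have hcm : Tendsto (fun δ : ℝ => x₀ - δ) (𝓝[>] 0) (𝓝[<] x₀) := by
    refine tendsto_nhdsWithin_iff.2 ⟨?_, ?_⟩
    · have : Tendsto (fun δ : ℝ => x₀ - δ) (𝓝 0) (𝓝 (x₀ - 0)) :=
        (continuous_const.sub continuous_id).tendsto 0
      rw [sub_zero] at this
      exact this.mono_left nhdsWithin_le_nhds
    · filter_upwards [self_mem_nhdsWithin] with δ hδ using sub_lt_self x₀ (mem_Ioi.1 hδ)
  have hcp : Tendsto (fun δ : ℝ => x₀ + δ) (𝓝[>] 0) (𝓝[>] x₀) := by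
    refine tendsto_nhdsWithin_iff.2 ⟨?_, ?_⟩
    · have : Tendsto (fun δ : ℝ => x₀ + δ) (𝓝 0) (𝓝 (x₀ + 0)) :=
        (continuous_const.add continuous_id).tendsto 0
      rw [add_zero] at this
      exact this.mono_left nhdsWithin_le_nhds
    · filter_upwards [self_mem_nhdsWithin] with δ hδ using lt_add_of_pos_right x₀ (mem_Ioi.1 hδ)
  have hcm' : Tendsto (fun δ : ℝ => x₀ - δ) (𝓝[>] 0) (𝓝 x₀) := hcm.mono_right nhdsWithin_le_nhds
  have hcp' : Tendsto (fun δ : ℝ => x₀ + δ) (𝓝[>] 0) (𝓝 x₀) := hcp.mono_right nhdsWithin_le_nhds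
  have hconst : Tendsto (fun _ : ℝ => x₀) (𝓝[>] 0) (𝓝 x₀) := tendsto_const_nhds
  have hside : x₀ ≠ 0 → ∀ᶠ δ in 𝓝[>] (0 : ℝ),
      x₀ - δ ≤ x₀ + δ ∧ ∀ x ∈ Ioc (x₀ - δ) (x₀ + δ), f x = f x₀ := fun hx0 => by
    rcases lt_or_gt_of_ne hx0 with hx | hx
    · filter_upwards [Ioo_mem_nhdsGT (neg_pos.2 hx)] with δ hδ
      refine ⟨by linarith [hδ.1], fun x hx' => ?_⟩
      rw [hfl x (by linarith [hx'.2, hδ.2]), hfl x₀ hx.le]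
    · filter_upwards [Ioo_mem_nhdsGT hx] with δ hδ
      refine ⟨by linarith [hδ.1], fun x hx' => ?_⟩
      rw [hfr x (by linarith [hx'.1, hδ.2]), hfr x₀ hx]
  have hsidel : x₀ = 0 → ∀ᶠ δ in 𝓝[>] (0 : ℝ),
      x₀ - δ ≤ x₀ ∧ ∀ x ∈ Ioc (x₀ - δ) x₀, f x = fl := fun hx0 => by
    filter_upwards [self_mem_nhdsWithin] with δ hδ
    exact ⟨sub_le_self _ (le_of_lt hδ), fun x hx => hfl x (hx.2.trans hx0.le)⟩
  have hsider : x₀ = 0 → ∀ᶠ δ in 𝓝[>] (0 : ℝ),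
      x₀ ≤ x₀ + δ ∧ ∀ x ∈ Ioc x₀ (x₀ + δ), f x = fr := fun hx0 => by
    filter_upwards [self_mem_nhdsWithin] with δ hδ
    exact ⟨le_add_of_nonneg_right (le_of_lt hδ), fun x hx => hfr x (hx0.ge.trans_lt hx.1)⟩
  refine ⟨?_, ?_, fun hlt hx0 => ?_, fun hlt hx0 => ?_, fun hlt hx0 => ?_, fun hlt hx0 => ?_⟩
  · rw [hFm]
    refine tendsto_const_nhds.congr' ?_
    filter_upwards [hgl] with x hx
    rw [hx]
  · rw [hFp]
    refine tendsto_const_nhds.congr' ?_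
    filter_upwards [hgr] with x hx
    rw [hx]
  · refine forall_mem_Icc_le_of_forall_mem_Ioo (hf.continuous x₀) (fun e => absurd e hlt.ne)
      fun k hk => ?_
    exact h.limit_flux_le_of_tendsto hlam hw hF₀ hF₀c (hf.continuous x₀) hcm' hcp' (hside hx0)
      (hcm.eventually (hum.eventually (gt_mem_nhds hk.1)))
      (hcp.eventually (hup.eventually (lt_mem_nhds hk.2)))
  · refine forall_mem_Icc_ge_of_forall_mem_Ioo (hf.continuous x₀) (fun e => absurd e hlt.ne)
      fun k hk => ?_
    exact h.le_limit_flux_of_tendsto hlam hw hF₀ hF₀c (hf.continuous x₀) hcm' hcp' (hside hx0)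
      (hcm.eventually (hum.eventually (lt_mem_nhds hk.2)))
      (hcp.eventually (hup.eventually (gt_mem_nhds hk.1)))
  -- The intermediate state is `u(0)` clamped to the jump interval. Levels below it are crossed on
  -- the left of the origin, under `fl`, and levels above it on the right, under `fr`.
  · refine ⟨max um (min (u x₀) up), ⟨le_max_left _ _, max_le hlt.le (min_le_right _ _)⟩,
      forall_mem_Icc_le_of_forall_mem_Ioo hflc (fun _ => ?_) fun k hk => ?_,
      forall_mem_Icc_le_of_forall_mem_Ioo hfrc (fun e => ?_) fun k hk => ?_⟩
    · rw [hFm, hgl0 hx0]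
    · have hk2 : k < u x₀ := by
        rcases lt_max_iff.1 hk.2 with h1 | h1
        · exact absurd hk.1 h1.not_gt
        · exact (lt_min_iff.1 h1).1
      exact h.limit_flux_le_of_tendsto hlam hw hF₀ hF₀c hflc hcm' hconst (hsidel hx0)
        (hcm.eventually (hum.eventually (gt_mem_nhds hk.1))) (Eventually.of_forall fun _ => hk2)
    · rw [e, hFp, hgr0 hx0]
    · have hk2 : u x₀ < k := by
        rcases min_lt_iff.1 ((le_max_right _ _).trans_lt hk.1) with h1 | h1
        · exact h1
        · exact absurd hk.2 h1.not_gt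
      exact h.limit_flux_le_of_tendsto hlam hw hF₀ hF₀c hfrc hconst hcp' (hsider hx0)
        (Eventually.of_forall fun _ => hk2) (hcp.eventually (hup.eventually (lt_mem_nhds hk.2)))
  · refine ⟨max up (min (u x₀) um), ⟨le_max_left _ _, max_le hlt.le (min_le_right _ _)⟩,
      forall_mem_Icc_ge_of_forall_mem_Ioo hfrc (fun _ => ?_) fun k hk => ?_,
      forall_mem_Icc_ge_of_forall_mem_Ioo hflc (fun e => ?_) fun k hk => ?_⟩
    · rw [hFp, hgr0 hx0]
    · have hk2 : k < u x₀ := by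
        rcases lt_max_iff.1 hk.2 with h1 | h1
        · exact absurd hk.1 h1.not_gt
        · exact (lt_min_iff.1 h1).1
      exact h.le_limit_flux_of_tendsto hlam hw hF₀ hF₀c hfrc hconst hcp' (hsider hx0)
        (Eventually.of_forall fun _ => hk2) (hcp.eventually (hup.eventually (gt_mem_nhds hk.1)))
    · rw [e, hFm, hgl0 hx0]
    · have hk2 : u x₀ < k := by
        rcases min_lt_iff.1 ((le_max_right _ _).trans_lt hk.1) with h1 | h1
        · exact h1
        · exact absurd hk.2 h1.not_gt
      exact h.le_limit_flux_of_tendsto hlam hw hF₀ hF₀c hflc hcm' hconst (hsidel hx0)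
        (hcm.eventually (hum.eventually (lt_mem_nhds hk.2))) (Eventually.of_forall fun _ => hk2)

end VanishingViscosity

/-! ### The entropy inequality -/

/-- `∫₀^y η'(s) g'(s) ds = η'(y) g(y) - ∫₀^y η''(s) g(s) ds` when `g 0 = 0`. -/
theorem integral_deriv_mul_deriv {η g : ℝ → ℝ} (hη : ContDiff ℝ ∞ η) (hg : ContDiff ℝ ∞ g)
    (hg0 : g 0 = 0) (y : ℝ) :
    ∫ s in (0 : ℝ)..y, deriv η s * deriv g s =
      deriv η y * g y - ∫ s in (0 : ℝ)..y, iteratedDeriv 2 η s * g s := by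
  have hη1 : ContDiff ℝ ∞ (deriv η) := (contDiff_infty_iff_deriv.1 hη).2
  have h1 := (IsPrimitive.of_contDiff (hg.of_le (by simp))).integral_parts
    (IsPrimitive.of_contDiff (hη1.of_le (by simp))) 0 y
  simp only [iteratedDeriv_succ, iteratedDeriv_zero]
  simp only [mul_comm (deriv g _)] at h1
  rw [h1, hg0, zero_mul, sub_zero, mul_comm (g y)]
  simp only [mul_comm (g _)]

theorem contDiff_integral_iteratedDeriv_mul {η g : ℝ → ℝ} (hη : ContDiff ℝ ∞ η)
    (hg : Continuous g) :
    ContDiff ℝ 1 (fun y => ∫ s in (0 : ℝ)..y, iteratedDeriv 2 η s * g s) ∧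
      ∀ y, deriv (fun y => ∫ s in (0 : ℝ)..y, iteratedDeriv 2 η s * g s) y =
        iteratedDeriv 2 η y * g y := by
  have hc : Continuous fun s => iteratedDeriv 2 η s * g s :=
    ((contDiff_infty.1 hη 2).continuous_iteratedDeriv 2 le_rfl).mul hg
  have hd : ∀ y, HasDerivAt (fun y => ∫ s in (0 : ℝ)..y, iteratedDeriv 2 η s * g s)
      (iteratedDeriv 2 η y * g y) y := fun y =>
    intervalIntegral.integral_hasDerivAt_right (hc.intervalIntegrable _ _)
      (hc.stronglyMeasurableAtFilter _ _) hc.continuousAt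
  refine ⟨contDiff_one_iff_deriv.2 ⟨fun y => (hd y).differentiableAt, ?_⟩, fun y => (hd y).deriv⟩
  rw [funext fun y => (hd y).deriv]
  exact hc

theorem ConvexOn.iteratedDeriv_two_nonneg {η : ℝ → ℝ} (hη : ContDiff ℝ ∞ η)
    (hc : ConvexOn ℝ univ η) (y : ℝ) : 0 ≤ iteratedDeriv 2 η y := by
  rw [iteratedDeriv_succ, iteratedDeriv_one]
  have : Monotone (deriv η) := monotoneOn_univ.1
    (hc.monotoneOn_deriv fun x _ => (hη.differentiable (by simp)) x)
  exact this.deriv_nonneg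

namespace ResolventPair

variable {f : ℝ → ℝ → ℝ} {fl fr : ℝ → ℝ} {lam ε : ℝ} {w v F : ℝ → ℝ} {η φ : ℝ → ℝ}

/-- The entropy balance of a viscous profile. -/
theorem entropy_inequality (hf : FluxF1 f fl fr) (hlam : 0 < lam) (hε : 0 < ε)
    (h : ResolventPair f lam ε w v F) (hη : ContDiff ℝ ∞ η) (hηc : ConvexOn ℝ univ η) (hφ : ContDiff ℝ ∞ φ)
    (hφc : HasCompactSupport φ) (hφ0 : ∀ x, 0 ≤ φ x) :
    lam * φ 0 * (∫ y in (0 : ℝ)..(v 0), iteratedDeriv 2 η y * (fr y - fl y))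
        - lam * (∫ x, entropyFlux f η x (v x) * deriv φ x)
        + ∫ x, deriv η (v x) * (v x - w x) * φ x
      ≤ lam * ε * ∫ x, η (v x) * deriv (deriv φ) x := by
  have hflc := hf.smooth_left.continuous
  have hfrc := hf.smooth_right.continuous
  have hη1 : ContDiff ℝ ∞ (deriv η) := (contDiff_infty_iff_deriv.1 hη).2
  have hφ1 : ContDiff ℝ ∞ (deriv φ) := (contDiff_infty_iff_deriv.1 hφ).2
  have hφdd : Continuous (deriv (deriv φ)) := hφ1.continuous_deriv (by simp)
  have h2c : Continuous (iteratedDeriv 2 η) :=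
    (contDiff_infty.1 hη 2).continuous_iteratedDeriv 2 le_rfl
  have hvc := h.profile.continuous
  have hFc := h.flux.continuous
  set p : ℝ → ℝ := fun x => (f x (v x) - F x) / ε with hp
  obtain ⟨r, hr, hφr, hφr1, hφr2⟩ : ∃ r : ℝ, 0 < r ∧ (∀ x, r ≤ |x| → φ x = 0) ∧
      (∀ x, r ≤ |x| → deriv φ x = 0) ∧ ∀ x, r ≤ |x| → deriv (deriv φ) x = 0 := by
    obtain ⟨r0, hr0, h0⟩ := hφc.exists_eq_zero_of_le_abs
    obtain ⟨r1, hr1, h1⟩ := hφc.deriv.exists_eq_zero_of_le_abs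
    obtain ⟨r2, hr2, h2⟩ := hφc.deriv.deriv.exists_eq_zero_of_le_abs
    exact ⟨max r0 (max r1 r2), lt_max_of_lt_left hr0,
      fun x hx => h0 x ((le_max_left _ _).trans hx),
      fun x hx => h1 x (((le_max_left _ _).trans (le_max_right _ _)).trans hx),
      fun x hx => h2 x (((le_max_right _ _).trans (le_max_right _ _)).trans hx)⟩
  have hφrr : φ r = 0 := hφr r (le_abs_self r)
  have hφrn : φ (-r) = 0 := hφr (-r) (by rw [abs_neg]; exact le_abs_self r)
  have hφ1r : deriv φ r = 0 := hφr1 r (le_abs_self r)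
  have hφ1n : deriv φ (-r) = 0 := hφr1 (-r) (by rw [abs_neg]; exact le_abs_self r)
  rw [integral_eq_intervalIntegral_of_eq_zero hr.le (fun x hx => by rw [hφr1 x hx, mul_zero]),
    integral_eq_intervalIntegral_of_eq_zero hr.le (fun x hx => by rw [hφr x hx, mul_zero]),
    integral_eq_intervalIntegral_of_eq_zero hr.le (fun x hx => by rw [hφr2 x hx, mul_zero])]
  have hφP : IsPrimitive φ (deriv φ) := IsPrimitive.of_contDiff (hφ.of_le (by simp))
  have hφ1P : IsPrimitive (deriv φ) (deriv (deriv φ)) :=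
    IsPrimitive.of_contDiff (hφ1.of_le (by simp))
  have hηv : IsPrimitive (fun x => deriv η (v x)) fun x => iteratedDeriv 2 η (v x) * p x := by
    have := h.profile.comp_contDiff (hη1.of_le (by simp))
    simpa only [iteratedDeriv_succ, iteratedDeriv_zero] using this
  have hfi : ∀ a b, IntervalIntegrable (fun x => f x (v x)) volume a b := fun a b =>
    (hf.integrable_comp h.integrable).intervalIntegrable
  have hpi := h.profile.intervalIntegrable
  -- The flux equation is tested with `η'(v) φ`.
  have e1 := h.flux.integral_parts (hηv.mul hφP) (-r) r
  simp only [hφrr, hφrn, mul_zero, sub_zero, zero_sub] at e1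
  have e1' : ∫ x in (-r)..r, deriv η (v x) * (v x - w x) * φ x =
      lam * ∫ x in (-r)..r, F x * (iteratedDeriv 2 η (v x) * p x * φ x
        + deriv η (v x) * deriv φ x) := by
    have : ∫ x in (-r)..r, deriv η (v x) * (v x - w x) * φ x =
        ∫ x in (-r)..r, -lam * ((w x - v x) / lam * (deriv η (v x) * φ x)) := by
      congr 1
      ext x
      field_simp
      ring
    rw [this, intervalIntegral.integral_const_mul, e1]
    ring
  have e3 := (h.profile.comp_contDiff (hη.of_le (by simp))).integral_parts hφ1P (-r) r
  simp only [hφ1r, hφ1n, mul_zero, sub_zero, zero_sub] at e3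
  -- For a flux independent of `x`, the term `η''(v) g(v) v'` is an exact derivative. Used with `fl`
  -- and `fr` on the two half lines, it leaves boundary values at the origin whose difference is the
  -- point mass.
  have hhalf : ∀ g : ℝ → ℝ, Continuous g → ∀ a b,
      ∫ x in a..b, iteratedDeriv 2 η (v x) * g (v x) * p x * φ x =
        (∫ s in (0 : ℝ)..v b, iteratedDeriv 2 η s * g s) * φ b
        - (∫ s in (0 : ℝ)..v a, iteratedDeriv 2 η s * g s) * φ a
        - ∫ x in a..b, (∫ s in (0 : ℝ)..v x, iteratedDeriv 2 η s * g s) * deriv φ x := by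
    intro g hg a b
    obtain ⟨hΦ, hΦd⟩ := contDiff_integral_iteratedDeriv_mul hη hg
    have := (h.profile.comp_contDiff hΦ).integral_parts hφP a b
    simpa only [hΦd] using this
  have hleft := hhalf fl hflc (-r) 0
  have hright := hhalf fr hfrc 0 r
  rw [hφrn, mul_zero, sub_zero] at hleft
  rw [hφrr, mul_zero, zero_sub] at hright
  have i2 : ∀ a b, IntervalIntegrable (fun x => iteratedDeriv 2 η (v x) * f x (v x) * p x * φ x)
      volume a b := fun a b => by
    have hl : IntervalIntegrable (fun x => (Iic 0).indicator
        (fun x => iteratedDeriv 2 η (v x) * fl (v x) * φ x * p x) x) volume a b := by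
      have := ((hpi a b).continuousOn_mul
        (by fun_prop : Continuous fun x => iteratedDeriv 2 η (v x) * fl (v x) * φ x).continuousOn)
      exact ⟨this.1.indicator measurableSet_Iic, this.2.indicator measurableSet_Iic⟩
    have hr' : IntervalIntegrable (fun x => (Ioi 0).indicator
        (fun x => iteratedDeriv 2 η (v x) * fr (v x) * φ x * p x) x) volume a b := by
      have := ((hpi a b).continuousOn_mul
        (by fun_prop : Continuous fun x => iteratedDeriv 2 η (v x) * fr (v x) * φ x).continuousOn)
      exact ⟨this.1.indicator measurableSet_Ioi, this.2.indicator measurableSet_Ioi⟩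
    refine (hl.add hr').congr_ae (Eventually.of_forall fun x => ?_)
    rcases le_or_gt x 0 with hx | hx
    · simp only [indicator, mem_Iic, hx, if_true, mem_Ioi, not_lt.2 hx, if_false, add_zero,
        hf.eq_left x _ hx]
      ring
    · simp only [indicator, mem_Iic, not_le.2 hx, if_true, mem_Ioi, hx, if_false, zero_add,
        hf.eq_right x _ hx]
      ring
  have e2l : ∫ x in (-r)..0, iteratedDeriv 2 η (v x) * f x (v x) * p x * φ x =
      ∫ x in (-r)..0, iteratedDeriv 2 η (v x) * fl (v x) * p x * φ x :=
    intervalIntegral.integral_congr_ae (Eventually.of_forall fun x hx => by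
      rw [uIoc_of_le (by linarith)] at hx
      rw [hf.eq_left x _ hx.2])
  have e2r : ∫ x in (0 : ℝ)..r, iteratedDeriv 2 η (v x) * f x (v x) * p x * φ x =
      ∫ x in (0 : ℝ)..r, iteratedDeriv 2 η (v x) * fr (v x) * p x * φ x :=
    intervalIntegral.integral_congr_ae (Eventually.of_forall fun x hx => by
      rw [uIoc_of_le hr.le] at hx
      rw [hf.eq_right x _ hx.1])
  have e2 := intervalIntegral.integral_add_adjacent_intervals (i2 (-r) 0) (i2 0 r)
  -- The primitives produced by `hhalf` are `η' f - q`, which brings in the entropy flux.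
  have hql : ∀ x ≤ 0, ∀ y, deriv η y * f x y - entropyFlux f η x y =
      ∫ s in (0 : ℝ)..y, iteratedDeriv 2 η s * fl s := fun x hx y => by
    have : f x = fl := funext fun y => hf.eq_left x y hx
    rw [entropyFlux, this, integral_deriv_mul_deriv hη hf.smooth_left hf.left_zero]
    ring
  have hqr : ∀ x > 0, ∀ y, deriv η y * f x y - entropyFlux f η x y =
      ∫ s in (0 : ℝ)..y, iteratedDeriv 2 η s * fr s := fun x hx y => by
    have : f x = fr := funext fun y => hf.eq_right x y hx
    rw [entropyFlux, this, integral_deriv_mul_deriv hη hf.smooth_right hf.right_zero]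
    ring
  have hΦlc := (contDiff_integral_iteratedDeriv_mul hη hflc).1.continuous
  have hΦrc := (contDiff_integral_iteratedDeriv_mul hη hfrc).1.continuous
  have hφ1c := hφ1.continuous
  have hη1c := hη1.continuous
  have hηf : ∀ a b, IntervalIntegrable (fun x => deriv η (v x) * f x (v x) * deriv φ x)
      volume a b := fun a b =>
    ((hfi a b).continuousOn_mul (by fun_prop : Continuous fun x => deriv η (v x) * deriv φ x
      ).continuousOn).congr_ae (Eventually.of_forall fun x => by ring)
  have il : IntervalIntegrable (fun x => (deriv η (v x) * f x (v x) - entropyFlux f η x (v x))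
      * deriv φ x) volume (-r) 0 := by
    have hc : Continuous fun x => (∫ s in (0 : ℝ)..v x, iteratedDeriv 2 η s * fl s) * deriv φ x :=
      (hΦlc.comp hvc).mul hφ1c
    refine (hc.intervalIntegrable (-r) 0).congr fun x hx => ?_
    rw [uIoc_of_le (by linarith)] at hx
    simp only [hql x hx.2]
  have ir : IntervalIntegrable (fun x => (deriv η (v x) * f x (v x) - entropyFlux f η x (v x))
      * deriv φ x) volume 0 r := by
    have hc : Continuous fun x => (∫ s in (0 : ℝ)..v x, iteratedDeriv 2 η s * fr s) * deriv φ x :=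
      (hΦrc.comp hvc).mul hφ1c
    refine (hc.intervalIntegrable 0 r).congr fun x hx => ?_
    rw [uIoc_of_le hr.le] at hx
    simp only [hqr x hx.1]
  have e4l : ∫ x in (-r)..0, (∫ s in (0 : ℝ)..v x, iteratedDeriv 2 η s * fl s) * deriv φ x =
      ∫ x in (-r)..0, (deriv η (v x) * f x (v x) - entropyFlux f η x (v x)) * deriv φ x :=
    intervalIntegral.integral_congr_ae (Eventually.of_forall fun x hx => by
      rw [uIoc_of_le (by linarith)] at hx
      rw [hql x hx.2])
  have e4r : ∫ x in (0 : ℝ)..r, (∫ s in (0 : ℝ)..v x, iteratedDeriv 2 η s * fr s) * deriv φ x =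
      ∫ x in (0 : ℝ)..r, (deriv η (v x) * f x (v x) - entropyFlux f η x (v x)) * deriv φ x :=
    intervalIntegral.integral_congr_ae (Eventually.of_forall fun x hx => by
      rw [uIoc_of_le hr.le] at hx
      rw [hqr x hx.1])
  have e4 := intervalIntegral.integral_add_adjacent_intervals il ir
  have hq : ∫ x in (-r)..r, entropyFlux f η x (v x) * deriv φ x =
      (∫ x in (-r)..r, deriv η (v x) * f x (v x) * deriv φ x)
      - ∫ x in (-r)..r, (deriv η (v x) * f x (v x) - entropyFlux f η x (v x)) * deriv φ x := by
    rw [← intervalIntegral.integral_sub (hηf _ _) (il.trans ir)]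
    congr 1
    ext x
    ring
  have e5 : ∫ y in (0 : ℝ)..(v 0), iteratedDeriv 2 η y * (fr y - fl y) =
      (∫ s in (0 : ℝ)..v 0, iteratedDeriv 2 η s * fr s)
      - ∫ s in (0 : ℝ)..v 0, iteratedDeriv 2 η s * fl s := by
    have i1 : IntervalIntegrable (fun s => iteratedDeriv 2 η s * fr s) volume 0 (v 0) :=
      (h2c.mul hfrc).intervalIntegrable _ _
    have i2 : IntervalIntegrable (fun s => iteratedDeriv 2 η s * fl s) volume 0 (v 0) :=
      (h2c.mul hflc).intervalIntegrable _ _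
    rw [← intervalIntegral.integral_sub i1 i2]
    simp only [mul_sub]
  have ip : IntervalIntegrable (fun x => ε * (deriv η (v x) * p x * deriv φ x))
      volume (-r) r := by
    refine (((hpi (-r) r).continuousOn_mul (by fun_prop : Continuous fun x =>
      deriv η (v x) * deriv φ x).continuousOn).const_mul ε).congr_ae
      (Eventually.of_forall fun x => by simp only [hp]; ring)
  have hineq : ∫ x in (-r)..r, F x * (iteratedDeriv 2 η (v x) * p x * φ x
        + deriv η (v x) * deriv φ x) ≤
      ∫ x in (-r)..r, (iteratedDeriv 2 η (v x) * f x (v x) * p x * φ x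
        + deriv η (v x) * f x (v x) * deriv φ x - ε * (deriv η (v x) * p x * deriv φ x)) := by
    refine intervalIntegral.integral_mono_on (by linarith)
      (((hηv.mul hφP).intervalIntegrable _ _).continuousOn_mul hFc.continuousOn)
      (((i2 _ _).add (hηf _ _)).sub ip) fun x _ => ?_
    have hFx : F x = f x (v x) - ε * p x := by
      simp only [hp]
      field_simp
      ring
    -- The dissipation term, nonnegative by convexity; discarding it is the only source of
    -- inequality.
    have h0 : 0 ≤ ε * (iteratedDeriv 2 η (v x) * p x ^ 2 * φ x) :=
      mul_nonneg hε.le (mul_nonneg (mul_nonneg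
        (ConvexOn.iteratedDeriv_two_nonneg hη hηc _) (sq_nonneg _)) (hφ0 x))
    rw [hFx]
    nlinarith
  rw [intervalIntegral.integral_sub ((i2 _ _).add (hηf _ _)) ip,
    intervalIntegral.integral_add (i2 _ _) (hηf _ _), intervalIntegral.integral_const_mul, e3,
    ← e2, e2l, e2r, hleft, hright, e4l, e4r] at hineq
  rw [e1', e5, hq, ← e4]
  have h3 := mul_le_mul_of_nonneg_left hineq hlam.le
  linarith

end ResolventPair

theorem tendsto_integral_mul_test {A : ℕ → ℝ → ℝ} {B ψ : ℝ → ℝ} {C : ℝ}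
    (hA : ∀ n, AEStronglyMeasurable (A n) volume) (hC : ∀ n, ∀ᵐ x, |A n x| ≤ C)
    (hlim : ∀ x, Tendsto (fun n => A n x) atTop (𝓝 (B x))) (hψ : Continuous ψ)
    (hψc : HasCompactSupport ψ) :
    Tendsto (fun n => ∫ x, A n x * ψ x) atTop (𝓝 (∫ x, B x * ψ x)) := by
  refine tendsto_integral_of_dominated_convergence (fun x => C * |ψ x|)
    (fun n => (hA n).mul hψ.aestronglyMeasurable)
    ((hψ.integrable_of_hasCompactSupport hψc).abs.const_mul C) (fun n => ?_)
    (Eventually.of_forall fun x => (hlim x).mul_const _)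
  filter_upwards [hC n] with x hx
  rw [norm_mul, Real.norm_eq_abs, Real.norm_eq_abs]
  gcongr

namespace VanishingViscosity

variable {f : ℝ → ℝ → ℝ} {fl fr : ℝ → ℝ} {lam : ℝ} {w : ℝ → ℝ} {ε : ℕ → ℝ} {v F : ℕ → ℝ → ℝ}
  {u : ℝ → ℝ}

/-- Every term of the viscous balance passes to the limit by dominated convergence or continuity,
and its right side is of order `ε`. The point mass involves `u(0)`, so convergence at the origin
itself is needed. -/
theorem entropyInequality (hf : FluxF1 f fl fr) (hlam : 0 < lam) (hwi : Integrable w volume)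
    (hw : ∀ᵐ x, 0 ≤ w x ∧ w x ≤ 1) (h : VanishingViscosity f lam w ε v F u) :
    EntropyInequality f fl fr lam w u := by
  intro η hη hηc φ hφ hφc hφ0
  have hη1 : ContDiff ℝ ∞ (deriv η) := (contDiff_infty_iff_deriv.1 hη).2
  have hφ1 : ContDiff ℝ ∞ (deriv φ) := (contDiff_infty_iff_deriv.1 hφ).2
  have hφdd : Continuous (deriv (deriv φ)) := hφ1.continuous_deriv (by simp)
  have h2c : Continuous (iteratedDeriv 2 η) :=
    (contDiff_infty.1 hη 2).continuous_iteratedDeriv 2 le_rfl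
  have hflc := hf.smooth_left.continuous
  have hfrc := hf.smooth_right.continuous
  have hvm : ∀ n, AEStronglyMeasurable (v n) volume := fun n =>
    (h.pair n).profile.continuous.aestronglyMeasurable
  have hbdd : ∀ g : ℝ → ℝ, Continuous g → ∃ C, ∀ y, 0 ≤ y → y ≤ 1 → |g y| ≤ C := fun g hg => by
    obtain ⟨C, hC⟩ := isCompact_Icc.exists_bound_of_continuousOn
      (hg.continuousOn (s := Icc (0 : ℝ) 1))
    exact ⟨C, fun y h0 h1 => hC y ⟨h0, h1⟩⟩
  have hprim : ∀ g : ℝ → ℝ, Continuous g → Continuous fun y => ∫ s in (0 : ℝ)..y, g s :=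
    fun g hg => intervalIntegral.continuous_primitive (fun a b => hg.intervalIntegrable a b) 0
  have t1 : Tendsto (fun n => lam * φ 0 *
      (∫ y in (0 : ℝ)..(v n 0), iteratedDeriv 2 η y * (fr y - fl y))) atTop
      (𝓝 (lam * φ 0 * (∫ y in (0 : ℝ)..(u 0), iteratedDeriv 2 η y * (fr y - fl y)))) :=
    (((hprim _ (h2c.mul (hfrc.sub hflc))).tendsto _).comp (h.tendsto 0)).const_mul _
  have hql := hprim (fun s => deriv η s * deriv fl s)
    (hη1.continuous.mul (hf.smooth_left.continuous_deriv (by simp)))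
  have hqr := hprim (fun s => deriv η s * deriv fr s)
    (hη1.continuous.mul (hf.smooth_right.continuous_deriv (by simp)))
  have hqleft : ∀ x ≤ 0, entropyFlux f η x = fun y => ∫ s in (0 : ℝ)..y, deriv η s * deriv fl s :=
    fun x hx => by
      have : f x = fl := funext fun y => hf.eq_left x y hx
      ext y
      rw [entropyFlux, this]
  have hqright : ∀ x > 0, entropyFlux f η x = fun y => ∫ s in (0 : ℝ)..y, deriv η s * deriv fr s :=
    fun x hx => by
      have : f x = fr := funext fun y => hf.eq_right x y hx
      ext y
      rw [entropyFlux, this]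
  obtain ⟨Cl, hCl⟩ := hbdd _ hql
  obtain ⟨Cr, hCr⟩ := hbdd _ hqr
  have t2 : Tendsto (fun n => ∫ x, entropyFlux f η x (v n x) * deriv φ x) atTop
      (𝓝 (∫ x, entropyFlux f η x (u x) * deriv φ x)) := by
    refine tendsto_integral_mul_test (C := max Cl Cr) (fun n => ?_)
      (fun n => Eventually.of_forall fun x => ?_) (fun x => ?_) hφ1.continuous hφc.deriv
    · have e : (fun x => entropyFlux f η x (v n x)) = fun x =>
          (Iic 0).indicator (fun x => ∫ s in (0 : ℝ)..v n x, deriv η s * deriv fl s) x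
          + (Ioi 0).indicator (fun x => ∫ s in (0 : ℝ)..v n x, deriv η s * deriv fr s) x := by
        ext x
        rcases le_or_gt x 0 with hx | hx
        · simp [hx, hqleft x hx]
        · simp [hx, hqright x hx]
      rw [e]
      exact ((hql.comp_aestronglyMeasurable (hvm n)).indicator measurableSet_Iic).add
        ((hqr.comp_aestronglyMeasurable (hvm n)).indicator measurableSet_Ioi)
    · rcases le_or_gt x 0 with hx | hx
      · rw [hqleft x hx]
        exact (hCl _ (h.mem_Icc n x).1 (h.mem_Icc n x).2).trans (le_max_left _ _)
      · rw [hqright x hx]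
        exact (hCr _ (h.mem_Icc n x).1 (h.mem_Icc n x).2).trans (le_max_right _ _)
    · rcases le_or_gt x 0 with hx | hx
      · rw [hqleft x hx]
        exact (hql.tendsto _).comp (h.tendsto x)
      · rw [hqright x hx]
        exact (hqr.tendsto _).comp (h.tendsto x)
  obtain ⟨C1, hC1⟩ := hbdd _ hη1.continuous
  have t3 : Tendsto (fun n => ∫ x, deriv η (v n x) * (v n x - w x) * φ x) atTop
      (𝓝 (∫ x, deriv η (u x) * (u x - w x) * φ x)) := by
    refine tendsto_integral_mul_test (C := C1) (fun n => ?_) (fun n => ?_) (fun x => ?_)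
      hφ.continuous hφc
    · exact (hη1.continuous.comp_aestronglyMeasurable (hvm n)).mul ((hvm n).sub hwi.1)
    · filter_upwards [hw] with x hx
      rw [abs_mul]
      have h1 := hC1 _ (h.mem_Icc n x).1 (h.mem_Icc n x).2
      refine (mul_le_of_le_one_right (abs_nonneg _) (abs_le.2 ⟨?_, ?_⟩)).trans h1
      · linarith [hx.2, (h.mem_Icc n x).1]
      · linarith [hx.1, (h.mem_Icc n x).2]
    · exact ((hη1.continuous.tendsto _).comp (h.tendsto x)).mul ((h.tendsto x).sub_const _)
  obtain ⟨C2, hC2⟩ := hbdd _ hη.continuous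
  have t4 : Tendsto (fun n => ∫ x, η (v n x) * deriv (deriv φ) x) atTop
      (𝓝 (∫ x, η (u x) * deriv (deriv φ) x)) :=
    tendsto_integral_mul_test (C := C2)
      (fun n => hη.continuous.comp_aestronglyMeasurable (hvm n))
      (fun n => Eventually.of_forall fun x => hC2 _ (h.mem_Icc n x).1 (h.mem_Icc n x).2)
      (fun x => (hη.continuous.tendsto _).comp (h.tendsto x)) hφdd hφc.deriv.deriv
  have t5 := (h.tendsto_zero.const_mul lam).mul t4
  rw [mul_zero, zero_mul] at t5
  exact le_of_tendsto_of_tendsto' ((t1.sub (t2.const_mul lam)).add t3) t5 fun n =>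
    (h.pair n).entropy_inequality hf hlam (h.pos n) hη hηc hφ hφc hφ0

end VanishingViscosity

/-! ### Compactness of the profiles and the main theorem -/

/-- Along a subsequence the viscous profiles converge everywhere, to a function of bounded
variation. -/
theorem exists_vanishingViscosity {f : ℝ → ℝ → ℝ} {fl fr : ℝ → ℝ} (hf : FluxF1 f fl fr)
    {lam : ℝ} (hlam : 0 < lam) {w : ℝ → ℝ} (hwi : Integrable w volume)
    (hw : ∀ᵐ x, 0 ≤ w x ∧ w x ≤ 1) (hwBV : MemBV w) {εs : ℕ → ℝ} (hpos : ∀ n, 0 < εs n)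
    (hlim : Tendsto εs atTop (𝓝 0)) :
    ∃ (σ : ℕ → ℕ) (F : ℕ → ℝ → ℝ) (u : ℝ → ℝ), StrictMono σ ∧ BoundedVariationOn u univ ∧
      VanishingViscosity f lam w (εs ∘ σ) (fun n => viscousResolvent f lam (εs (σ n)) w) F u := by
  choose F hF using fun n => exists_resolventPair_viscousResolvent hf hlam (hpos n) hwi
  set v : ℕ → ℝ → ℝ := fun n => viscousResolvent f lam (εs n) w with hv
  have hv01 : ∀ n x, 0 ≤ v n x ∧ v n x ≤ 1 := fun n x =>
    ⟨(hF n).nonneg hf hlam (hpos n) hwi (hw.mono fun _ h => h.1) x, (hF n).le_one hf hlam (hpos n) hwi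
      (hw.mono fun _ h => h.2) x⟩
  obtain ⟨M, hM0, hM⟩ := hwBV.exists_integral_abs_translate_le
  choose G hGm hGb hvG using fun n =>
    (hF n).exists_monotone_add_monotone hf hlam (hpos n) hwi hw (hv01 n) hM
  -- Helly's theorem is applied in turn to the increasing functions `v + G` and `G`; the profiles
  -- converge to the difference of the limits.
  obtain ⟨σ₁, g₁, hσ₁, hg₁⟩ := exists_subseq_tendsto_of_monotone (h := fun n x => v n x + G n x)
    (C := 1 + (M + 2)) hvG fun n x => (abs_add_le _ _).trans
      (add_le_add (abs_le.2 ⟨by linarith [(hv01 n x).1], (hv01 n x).2⟩) (hGb n x))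
  obtain ⟨σ₂, g₂, hσ₂, hg₂⟩ := exists_subseq_tendsto_of_monotone (h := fun n => G (σ₁ n))
    (C := M + 2) (fun n => hGm _) fun n x => hGb _ x
  have hg₁' : ∀ x, Tendsto (fun n => v (σ₁ (σ₂ n)) x + G (σ₁ (σ₂ n)) x) atTop (𝓝 (g₁ x)) :=
    fun x => (hg₁ x).comp hσ₂.tendsto_atTop
  have hvu : ∀ x, Tendsto (fun n => v (σ₁ (σ₂ n)) x) atTop (𝓝 (g₁ x - g₂ x)) := fun x => by
    simpa using (hg₁' x).sub (hg₂ x)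
  have hm₁ : Monotone g₁ := fun x y hxy =>
    le_of_tendsto_of_tendsto' (hg₁ x) (hg₁ y) fun n => hvG _ hxy
  have hm₂ : Monotone g₂ := fun x y hxy =>
    le_of_tendsto_of_tendsto' (hg₂ x) (hg₂ y) fun n => hGm _ hxy
  have hb₂ : ∀ x, |g₂ x| ≤ M + 2 := fun x => le_of_tendsto' (hg₂ x).abs fun n => hGb _ x
  have hb₁ : ∀ x, |g₁ x - g₂ x| ≤ 1 := fun x => le_of_tendsto' (hvu x).abs fun n =>
    abs_le.2 ⟨by linarith [(hv01 (σ₁ (σ₂ n)) x).1], (hv01 _ x).2⟩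
  refine ⟨σ₁ ∘ σ₂, fun n => F (σ₁ (σ₂ n)), fun x => g₁ x - g₂ x, hσ₁.comp hσ₂, ?_, ?_⟩
  -- Increments of `g₁ - g₂` are dominated by those of the bounded increasing function `g₁ + g₂`.
  · refine boundedVariationOn_of_abs_sub_le (G := fun x => g₁ x + g₂ x) (C := 1 + 2 * (M + 2))
      (hm₁.add hm₂) (fun x => ?_) fun x y hxy => ?_
    · have := abs_le.1 (hb₁ x)
      have := abs_le.1 (hb₂ x)
      exact abs_le.2 ⟨by linarith, by linarith⟩
    · have := hm₁ hxy
      have := hm₂ hxy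
      exact abs_le.2 ⟨by linarith, by linarith⟩
  · exact
      { pos := fun n => hpos _
        tendsto_zero := hlim.comp (hσ₁.comp hσ₂).tendsto_atTop
        pair := fun n => hF _
        mem_Icc := fun n x => hv01 _ x
        tendsto := hvu }

end

theorem mainTheorem3 (f : ℝ → ℝ → ℝ) (fl fr : ℝ → ℝ) (hf : FluxF1 f fl fr)
    (lam : ℝ) (hlam : 0 < lam) (w : ℝ → ℝ) (hwD : w ∈ domainD) (hwBV : MemBV w) :
    -- the resolvent is well defined
    (∀ ε : ℝ, 0 < ε →
      IsViscousResolvent f lam ε w (viscousResolvent f lam ε w) ∧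
      ∀ v : ℝ → ℝ, Integrable v volume → IsWeakSolution f lam ε w v →
        v =ᵐ[volume] viscousResolvent f lam ε w) ∧
    ∀ εs : ℕ → ℝ, (∀ n, 0 < εs n) → Tendsto εs atTop (𝓝 0) →
      ∃ (σ : ℕ → ℕ) (u : ℝ → ℝ), StrictMono σ ∧
        (∀ x : ℝ, Tendsto (fun j => viscousResolvent f lam (εs (σ j)) w x) atTop (𝓝 (u x))) ∧
        Integrable u volume ∧ BoundedVariationOn u univ ∧
        SolvesLimitEquation f lam w u ∧
        EntropyInequality f fl fr lam w u ∧
        ∀ x₀ : ℝ, ¬ ContinuousAt u x₀ →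
          ∃ um up fbar : ℝ,
            Tendsto u (𝓝[<] x₀) (𝓝 um) ∧ Tendsto u (𝓝[>] x₀) (𝓝 up) ∧
            Tendsto (fun x => f x um) (𝓝[<] x₀) (𝓝 fbar) ∧
            Tendsto (fun x => f x up) (𝓝[>] x₀) (𝓝 fbar) ∧
            (um < up → x₀ ≠ 0 → ∀ k ∈ Icc um up, fbar ≤ f x₀ k) ∧
            (up < um → x₀ ≠ 0 → ∀ k ∈ Icc up um, f x₀ k ≤ fbar) ∧
            (um < up → x₀ = 0 → ∃ us ∈ Icc um up,
              (∀ k ∈ Icc um us, fbar ≤ fl k) ∧ (∀ k ∈ Icc us up, fbar ≤ fr k)) ∧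
            (up < um → x₀ = 0 → ∃ us ∈ Icc up um,
              (∀ k ∈ Icc up us, fr k ≤ fbar) ∧ (∀ k ∈ Icc us um, fl k ≤ fbar)) := by
  obtain ⟨hwi, hw⟩ := hwD
  refine ⟨fun ε hε => ⟨isViscousResolvent_viscousResolvent hf hlam hε hwi, fun v hv h =>
    ae_eq_viscousResolvent hf hlam hε hwi hv h⟩, fun εs hpos hlim => ?_⟩
  obtain ⟨σ, F, u, hσ, hBV, h⟩ := exists_vanishingViscosity hf hlam hwi hw hwBV hpos hlim
  obtain ⟨F₀, hF₀, hF₀p, hae⟩ := h.exists_limit_flux hf hlam hwi hw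
  refine ⟨σ, u, hσ, h.tendsto, h.integrable_limit hf hlam hwi, hBV,
    solvesLimitEquation_of_isPrimitive hlam hwi (h.integrable_limit hf hlam hwi) hF₀p hae,
    h.entropyInequality hf hlam hwi hw, fun x₀ _ => ?_⟩
  obtain ⟨um, hum⟩ := hBV.exists_tendsto_left x₀
  obtain ⟨up, hup⟩ := hBV.exists_tendsto_right x₀
  rw [univ_inter] at hum hup
  exact ⟨um, up, F₀ x₀, hum, hup,
    h.jump_conditions hf hlam hw hF₀ hF₀p.continuous hae hum hup⟩
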